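/- **Setting.** Let $0<R_1\le R_2\le D$, $\lambda>0$, $\beta>0$ and $\alpha\ge 2$. A transmitter is at the origin $o$ of $\mathbb R^2$ and its receiver is at a point $y_0$ with $\|y_0\|=l$, $0<l\le D$. The legitimate nodes form a homogeneous Poisson point process $\Phi$ of intensity $\lambda$ on the disk $\mathcal B(o,D)$. Every $x\in\Phi$ with $\|x\|\le R_1$ is a jammer, and every $x\in\Phi$ with $R_1<\|x\|\le R_2$ is a jammer with probability $P(\|x\|)$, the selections being independent given $\Phi$; no other node is one. The selection policy $\Xi$ is one of: Policy E, $P(r)=p$ with a constant $p\in[0,1]$; Policy I, $P(r)=\frac{r^\alpha-R_1^\alpha}{R_2^\alpha-R_1^\alpha}$; Policy D, $P(r)=\frac{R_2^\alpha-r^\alpha}{R_2^\alpha-R_1^\alpha}$. For the policies I and D it is assumed that $R_1<R_2$. Let $\Phi_J$ be the set of jammers and $I(y_0)=\sum_{x\in\Phi_J}h_{x,y_0}\|x-y_0\|^{-\alpha}$, where the fading coefficients $h_{x,y_0}$ ($x\in\Phi$) and $h_{o,y_0}$ are exponential with mean $1$ and are independent of each other, of $\Phi$ and of the selection. Put $\mathrm{SIR}_{y_0}=h_{o,y_0}l^{-\alpha}/I(y_0)$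 (which is $+\infty$ if $I(y_0)=0$), let $p_{to}=\mathbb P(\mathrm{SIR}_{y_0}<\beta)$ be the transmission outage probability, and let $\mathcal L^{\Xi,\alpha}_{I(y_0)}(s)=\mathbb E[e^{-sI(y_0)}]$. **Theorem.** For each policy $\Xi\in\{\mathrm E,\mathrm I,\mathrm D\}$ and every $\alpha\ge2$, $$p_{to}=1-\mathcal L^{\Xi,\alpha}_{I(y_0)}(\beta l^\alpha).$$ For $\alpha=2$ and $\alpha=4$, the value $\mathcal L^{\Xi,\alpha}_{I(y_0)}(s)$ at $s=\beta l^\alpha$ is given by the following formulas. *Case $\alpha=2$.* Write $A(r)=\operatorname{arcsinh}\frac{s+r^2-l^2}{2l\sqrt s}$, $Q(r)=\sqrt{r^4+2(s-l^2)r^2+(s+l^2)^2}$ and $c=\ln\frac{\sqrt s}{l}$. Then $$\mathcal L^{\mathrm E,2}_{I(y_0)}(s)=\exp\{-\lambda\pi s[\,pA(R_2)+(1-p)A(R_1)-c\,]\},$$ $$\mathcal L^{\Xi,2}_{I(y_0)}(s)=\exp\{-\lambda\pi s[\,\Psi_2^{\Xi}(R_2)-\Psi_2^{\Xi}(R_1)+A(R_1)-c\,]\}\qquad(\Xi=\mathrm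 I,\mathrm D),$$ $$\Psi_2^{\mathrm I}(r)=\frac{Q(r)-(s+R_1^2-l^2)A(r)}{R_2^2-R_1^2},\qquad \Psi_2^{\mathrm D}(r)=\frac{(s+R_2^2-l^2)A(r)-Q(r)}{R_2^2-R_1^2}.$$ *Case $\alpha=4$.* Write $g(r)=(r^2-l^2)^2-s$, $\eta(r)=\frac1{\sqrt2}\sqrt{\sqrt{g(r)^2+4s(r^2+l^2)^2}+g(r)}$, $\psi(r)=\frac{\sqrt s\,(r^2+l^2)}{\eta(r)}$, $T(r)=\arctan\frac{\sqrt s+\psi(r)}{\eta(r)+r^2-l^2}$, $M(r)=\ln[(\eta(r)+r^2-l^2)^2+(\sqrt s+\psi(r))^2]$ and $K(r)=(r^2+3l^2)\psi(r)-3\sqrt s\,\eta(r)$. Then $$\mathcal L^{\mathrm E,4}_{I(y_0)}(s)=\exp\{-\lambda\pi\sqrt s\,[\tfrac\pi2-(1-p)T(R_1)-pT(R_2)]\},$$ $$\mathcal L^{\Xi,4}_{I(y_0)}(s)=\exp\{-\lambda\pi\sqrt s\,[\tfrac\pi2-T(R_1)+\Psi_4^{\Xi}(R_2)-\Psi_4^{\Xi}(R_1)]\}\qquad(\Xi=\mathrm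 I,\mathrm D),$$ $$\Psi_4^{\mathrm I}(r)=\frac{2\sqrt s\,l^2M(r)-\frac12K(r)+(s+R_1^4-l^4)T(r)}{R_2^4-R_1^4},$$ $$\Psi_4^{\mathrm D}(r)=-\frac{2\sqrt s\,l^2M(r)-\frac12K(r)+(s+R_2^4-l^4)T(r)}{R_2^4-R_1^4}.$$ -/

import Mathlib

open MeasureTheory ProbabilityTheory
open scoped NNReal ENNReal

namespace FriendlyJamming

noncomputable section

/-- The Euclidean plane. -/
abbrev Plane : Type := EuclideanSpace ℝ (Fin 2)

/-- `Φ` is a Poisson point process (as a random measure) with intensity measure `Λ`: the number of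
points in a measurable set `A` is a Poisson variable with mean `Λ A` (and is infinite almost surely
if `Λ A = ∞`), and the numbers of points in pairwise disjoint measurable sets are independent. -/
structure IsPoissonProcess {Ω S : Type*} [MeasurableSpace Ω] [MeasurableSpace S]
    (Φ : Ω → Measure S) (Λ : Measure S) (P : Measure Ω) : Prop where
  measurable_count : ∀ A : Set S, MeasurableSet A → Measurable (fun ω => Φ ω A)
  law_count : ∀ A : Set S, MeasurableSet A → Λ A ≠ ∞ →
    HasLaw (fun ω => Φ ω A) ((poissonMeasure (Λ A).toNNReal).map (Nat.cast : ℕ → ℝ≥0∞)) P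
  count_of_infinite : ∀ A : Set S, MeasurableSet A → Λ A = ∞ → ∀ᵐ ω ∂P, Φ ω A = ∞
  indep_count : ∀ (n : ℕ) (A : Fin n → Set S), (∀ i, MeasurableSet (A i)) →
    Pairwise (Function.onFun Disjoint A) → iIndepFun (fun i ω => Φ ω (A i)) P

/-- The counting measure of the finite configuration `x 0, …, x (n - 1)`. -/
def countingMeasure (n : ℕ) (x : ℕ → Plane) : Measure Plane :=
  ∑ i ∈ Finset.range n, Measure.dirac (x i)

/-- The random network. The legitimate nodes are `X 0, …, X (N - 1)` (in some enumeration) and form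
a homogeneous Poisson process of intensity `lam` on the disk of radius `D` about the origin.
The `i`-th node carries a mark `U i`, uniform on `[0, 1]`, that decides its selection (it is
selected with probability `q` by means of the event `U i ≤ q`), and the unit-mean exponential
(Rayleigh) fading `h i` of its link to the receiver; `h₀` is the unit-mean exponential fading of the
link from the transmitter to the receiver. All marks and fadings are mutually independent, and
independent of the configuration of the nodes. -/
structure IsNetwork {Ω : Type*} [MeasurableSpace Ω] (P : Measure Ω) (lam D : ℝ)
    (N : Ω → ℕ) (X : ℕ → Ω → Plane) (U h : ℕ → Ω → ℝ) (h₀ : Ω → ℝ) : Prop where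
  measurable_num : Measurable N
  measurable_node : ∀ i, Measurable (X i)
  poisson : IsPoissonProcess (fun ω => countingMeasure (N ω) (fun i => X i ω))
    (ENNReal.ofReal lam • volume.restrict (Metric.closedBall (0 : Plane) D)) P
  law_mark : ∀ i, HasLaw (U i) (volume.restrict (Set.Icc (0 : ℝ) 1)) P
  law_fading : ∀ i, HasLaw (h i) (expMeasure 1) P
  law_fading_zero : HasLaw h₀ (expMeasure 1) P
  indep_marks : iIndepFun (Sum.elim U (Sum.elim h (fun _ : Unit => h₀))) P
  indep_nodes_marks : IndepFun (fun ω => (N ω, fun i => X i ω))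
    (fun ω (k : ℕ ⊕ ℕ ⊕ Unit) => Sum.elim U (Sum.elim h (fun _ : Unit => h₀)) k ω) P

/-- The three selection policies for long-range jammers. -/
inductive Policy where
  | E (p : Set.Icc (0 : ℝ) 1)
  | I
  | D

/-- The probability with which a node at distance `r` from the transmitter is selected, for
`R₁ < r ≤ R₂`, if the path loss exponent is `α`. -/
def Policy.prob (α R₁ R₂ r : ℝ) : Policy → ℝ
  | .E p => p
  | .I => (r ^ α - R₁ ^ α) / (R₂ ^ α - R₁ ^ α)
  | .D => (R₂ ^ α - r ^ α) / (R₂ ^ α - R₁ ^ α)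

/-- A node at `x` with mark `u` is a jammer: either it lies in the local friendship circle, or it
lies in the long-range friendship annulus and is selected. -/
def IsJammer (pol : Policy) (α R₁ R₂ : ℝ) (x : Plane) (u : ℝ) : Prop :=
  ‖x‖ ≤ R₁ ∨ (R₁ < ‖x‖ ∧ ‖x‖ ≤ R₂ ∧ u ≤ pol.prob α R₁ R₂ ‖x‖)

open Classical in
/-- The sum interference at `y`: the sum of `h_x * ‖x - y‖ ^ (-α)` over the jammers `x`. -/
def interference {Ω : Type*} (pol : Policy) (α R₁ R₂ : ℝ) (N : Ω → ℕ) (X : ℕ → Ω → Plane)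
    (U h : ℕ → Ω → ℝ) (y : Plane) (ω : Ω) : ℝ :=
  ∑ i ∈ Finset.range (N ω) with IsJammer pol α R₁ R₂ (X i ω) (U i ω),
    h i ω * ‖X i ω - y‖ ^ (-α)

/-- The Laplace transform `𝔼[exp (-s J)]` of a random variable `J`. -/
def laplaceTransform {Ω : Type*} [MeasurableSpace Ω] (P : Measure Ω) (J : Ω → ℝ) (s : ℝ) : ℝ :=
  ∫ ω, Real.exp (-(s * J ω)) ∂P

/-- The signal-to-interference ratio at distance `l` from the transmitter, for fading `g` of the
desired link and sum interference `J`. It takes values in `[0, ∞]`: it is infinite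
if there is a signal and no interference. -/
def sir (α l g J : ℝ) : ℝ≥0∞ := ENNReal.ofReal (g * l ^ (-α)) / ENNReal.ofReal J

/-- The transmission outage probability: the probability that the signal-to-interference ratio
at the receiver `y₀` is below the threshold `β`. -/
def transmissionOutage {Ω : Type*} [MeasurableSpace Ω] (P : Measure Ω) (pol : Policy)
    (α R₁ R₂ : ℝ) (N : Ω → ℕ) (X : ℕ → Ω → Plane) (U h : ℕ → Ω → ℝ) (h₀ : Ω → ℝ)
    (y₀ : Plane) (β : ℝ) : ℝ :=
  P.real {ω | sir α ‖y₀‖ (h₀ ω) (interference pol α R₁ R₂ N X U h y₀ ω) < ENNReal.ofReal β}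

/-! ### Closed form for path loss exponent 2 (`d` is the distance of the location to the origin) -/

/-- `arsinh ((s + r² - d²) / (2 d √s))`. -/
def ash (r s d : ℝ) : ℝ := Real.arsinh ((s + r ^ 2 - d ^ 2) / (2 * d * √s))

/-- `√(r⁴ + 2 (s - d²) r² + (s + d²)²)`. -/
def rad (r s d : ℝ) : ℝ := √(r ^ 4 + 2 * (s - d ^ 2) * r ^ 2 + (s + d ^ 2) ^ 2)

def Psi2I (R₁ R₂ r s d : ℝ) : ℝ :=
  rad r s d / (R₂ ^ 2 - R₁ ^ 2) - (s + R₁ ^ 2 - d ^ 2) / (R₂ ^ 2 - R₁ ^ 2) * ash r s d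

def Psi2D (R₁ R₂ r s d : ℝ) : ℝ :=
  (s + R₂ ^ 2 - d ^ 2) / (R₂ ^ 2 - R₁ ^ 2) * ash r s d - rad r s d / (R₂ ^ 2 - R₁ ^ 2)

def laplace2 (lam R₁ R₂ s d : ℝ) : Policy → ℝ
  | .E p => Real.exp (-(lam * Real.pi * s *
      (p * ash R₂ s d + (1 - p) * ash R₁ s d - Real.log (√s / d))))
  | .I => Real.exp (-(lam * Real.pi * s *
      (Psi2I R₁ R₂ R₂ s d - Psi2I R₁ R₂ R₁ s d + (ash R₁ s d - Real.log (√s / d)))))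
  | .D => Real.exp (-(lam * Real.pi * s *
      (Psi2D R₁ R₂ R₂ s d - Psi2D R₁ R₂ R₁ s d + (ash R₁ s d - Real.log (√s / d)))))

/-! ### Closed form for path loss exponent 4 -/

def g4 (r s d : ℝ) : ℝ := (r ^ 2 - d ^ 2) ^ 2 - s

def eta (r s d : ℝ) : ℝ :=
  √(√(g4 r s d ^ 2 + 4 * s * (r ^ 2 + d ^ 2) ^ 2) + g4 r s d) / √2

def psi (r s d : ℝ) : ℝ := √s * (r ^ 2 + d ^ 2) / eta r s d

/-- `arctan ((√s + ψ) / (η + r² - d²))`. -/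
def atn (r s d : ℝ) : ℝ := Real.arctan ((√s + psi r s d) / (eta r s d + r ^ 2 - d ^ 2))

def Psi4I (R₁ R₂ r s d : ℝ) : ℝ :=
  2 * √s * d ^ 2 / (R₂ ^ 4 - R₁ ^ 4) *
      Real.log ((eta r s d + r ^ 2 - d ^ 2) ^ 2 + (√s + psi r s d) ^ 2)
    - 1 / (2 * (R₂ ^ 4 - R₁ ^ 4)) *
      ((r ^ 2 + 3 * d ^ 2) * psi r s d - 3 * √s * eta r s d)
    + (s + R₁ ^ 4 - d ^ 4) / (R₂ ^ 4 - R₁ ^ 4) * atn r s d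

def Psi4D (R₁ R₂ r s d : ℝ) : ℝ :=
  -(2 * √s * d ^ 2 / (R₂ ^ 4 - R₁ ^ 4)) *
      Real.log ((eta r s d + r ^ 2 - d ^ 2) ^ 2 + (√s + psi r s d) ^ 2)
    + 1 / (2 * (R₂ ^ 4 - R₁ ^ 4)) *
      ((r ^ 2 + 3 * d ^ 2) * psi r s d - 3 * √s * eta r s d)
    - (s + R₂ ^ 4 - d ^ 4) / (R₂ ^ 4 - R₁ ^ 4) * atn r s d

def laplace4 (lam R₁ R₂ s d : ℝ) : Policy → ℝ
  | .E p => Real.exp (-(lam * Real.pi * √s *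
      (Real.pi / 2 - (1 - p) * atn R₁ s d - p * atn R₂ s d)))
  | .I => Real.exp (-(lam * Real.pi * √s *
      (Real.pi / 2 - atn R₁ s d + Psi4I R₁ R₂ R₂ s d - Psi4I R₁ R₂ R₁ s d)))
  | .D => Real.exp (-(lam * Real.pi * √s *
      (Real.pi / 2 - atn R₁ s d + Psi4D R₁ R₂ R₂ s d - Psi4D R₁ R₂ R₁ s d)))

end

end FriendlyJamming

/-! Since the fading of the desired link is a unit exponential independent of everything else, it
exceeds `s * I` with conditional probability `exp (-s * I)`; with `s = β * l ^ α` this is exactly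
non-outage, so the success probability is the Laplace transform of the interference at `s`
(`IsNetwork.transmissionOutage_eq`).

To compute that transform, fix the nodes and average over marks and fadings. These are independent,
so the average is a product over nodes, with factor `1 - q(‖x‖) * (1 - 1 / (1 + s * ‖x - y‖ ^
(-α)))` for a node at `x`, where `q` is the jamming probability. The probability generating
functional of the Poisson process (`IsPoissonProcess.integral_prod`) turns the mean of this product
into `exp (-λ ∫ q(‖x‖) * s / (s + ‖x - y‖ ^ α))` over the disk (`IsNetwork.laplaceTransform_eq`).

For `α = 2, 4` the integral is evaluated in polar coordinates. The angular part reduces to `∫ dθ /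
(A - B cos θ) = 2π / w`, `w² = A² - B²`, proved for complex `A` by Cauchy's formula
(`integral_inv_sub_mul_cos`). For `α = 2`, `A` is real. For `α = 4` the kernel is `-√s` times the
imaginary part of `1 / (u + i√s)`, `u` being the squared distance, so `A` is complex and the answer
is an imaginary part.

In both cases `w²` is a quadratic polynomial in `r²`, and the selection probability is constant or
affine in `r ^ α`. Hence the radial part needs only antiderivatives of `2r / w` and `r ^ α * 2r /
w`. They are elementary: `arsinh` and `w` for `α = 2`, a complex logarithm and `w` for `α = 4`. The
real and imaginary parts of the logarithm give the `ln` and `arctan` terms. -/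

namespace FriendlyJamming

open Filter Topology

/-! ### Laplace and probability generating functionals of a Poisson process. -/

section LaplaceFunctional

lemma integral_exp_neg_mul_poissonMeasure (r : ℝ≥0) (c : ℝ) :
    ∫ x, Real.exp (-(c * x.toReal)) ∂((poissonMeasure r).map (Nat.cast : ℕ → ℝ≥0∞)) =
      Real.exp (-(r * (1 - Real.exp (-c)))) := by
  rw [integral_map (by fun_prop) (by fun_prop), integral_poissonMeasure]
  have h1 : ∀ n : ℕ, (Real.exp (-(r : ℝ)) * (r : ℝ) ^ n / (n.factorial : ℝ)) •
      Real.exp (-(c * ((n : ℝ≥0∞)).toReal)) =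
      Real.exp (-(r : ℝ)) * ((r * Real.exp (-c)) ^ n / n.factorial) := by
    intro n
    rw [mul_pow, ← Real.exp_nat_mul]
    simp only [ENNReal.toReal_natCast, smul_eq_mul]
    rw [show -(c * (n : ℝ)) = n * -c by ring]
    ring
  simp_rw [h1]
  rw [tsum_mul_left, ← congrFun (NormedSpace.exp_eq_tsum_div (𝔸 := ℝ)) _, ← Real.exp_eq_exp_ℝ, ← Real.exp_add]
  congr 1
  ring

variable {Ω S : Type*} [MeasurableSpace Ω] [MeasurableSpace S] {Φ : Ω → Measure S}
  {Λ : Measure S} {P : Measure Ω}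

lemma IsPoissonProcess.integral_exp_neg_mul_count [IsFiniteMeasure Λ]
    (hΦ : IsPoissonProcess Φ Λ P) {A : Set S} (hA : MeasurableSet A) (c : ℝ) :
    ∫ ω, Real.exp (-(c * (Φ ω A).toReal)) ∂P =
      Real.exp (-(Λ.real A * (1 - Real.exp (-c)))) := by
  have h := (hΦ.law_count A hA (measure_ne_top _ _)).integral_comp
    (f := fun x : ℝ≥0∞ => Real.exp (-(c * x.toReal))) (by fun_prop)
  rw [integral_exp_neg_mul_poissonMeasure] at h
  exact h

/-- The Laplace functional of a Poisson process at a simple function. -/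
lemma IsPoissonProcess.integral_exp_neg_simpleFunc [IsFiniteMeasure Λ] [IsProbabilityMeasure P]
    [∀ ω, IsFiniteMeasure (Φ ω)] (hΦ : IsPoissonProcess Φ Λ P) (f : SimpleFunc S ℝ≥0∞)
    (hf : ∀ x, f x ≠ ∞) :
    ∫ ω, Real.exp (-(∫⁻ x, f x ∂(Φ ω)).toReal) ∂P =
      Real.exp (-∫ x, (1 - Real.exp (-(f x).toReal)) ∂Λ) := by
  have hr : ∀ c ∈ f.range, c ≠ ∞ := by
    intro c hc
    obtain ⟨x, rfl⟩ := SimpleFunc.mem_range.1 hc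
    exact hf x
  have h1 : ∀ ω, Real.exp (-(∫⁻ x, f x ∂(Φ ω)).toReal) =
      ∏ c : f.range, Real.exp (-((c : ℝ≥0∞).toReal * (Φ ω (f ⁻¹' {(c : ℝ≥0∞)})).toReal)) := by
    intro ω
    rw [← Real.exp_sum, Finset.sum_neg_distrib, SimpleFunc.lintegral_eq_lintegral f,
      SimpleFunc.lintegral, ENNReal.toReal_sum
        (fun c hc => ENNReal.mul_ne_top (hr c hc) (measure_ne_top _ _)), ← Finset.sum_coe_sort]
    simp [ENNReal.toReal_mul]
  have h2 : ∫ x, (1 - Real.exp (-(f x).toReal)) ∂Λ =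
      ∑ c : f.range, Λ.real (f ⁻¹' {(c : ℝ≥0∞)}) * (1 - Real.exp (-(c : ℝ≥0∞).toReal)) := by
    have h3 : ∀ x, 1 - Real.exp (-(f x).toReal) = ∑ c : f.range,
        (f ⁻¹' {(c : ℝ≥0∞)}).indicator (fun _ => 1 - Real.exp (-(c : ℝ≥0∞).toReal)) x := by
      intro x
      rw [Finset.sum_eq_single (⟨f x, SimpleFunc.mem_range_self f x⟩ : f.range)]
      · simp
      · intro c _ hc
        refine Set.indicator_of_notMem (fun h => hc (Subtype.ext ?_)) _
        simpa using Eq.symm h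
      · simp
    simp_rw [h3]
    rw [integral_finsetSum]
    · refine Finset.sum_congr rfl fun c _ => ?_
      rw [integral_indicator_const _ (f.measurableSet_preimage _), smul_eq_mul]
    · exact fun c _ => (integrable_const _).indicator (f.measurableSet_preimage _)
  have hind : iIndepFun (fun (c : f.range) ω => Φ ω (f ⁻¹' {(c : ℝ≥0∞)})) P := by
    -- Level sets of distinct values are disjoint. Independence is postulated for families over `Fin
    -- n`, so the range is enumerated and the result is transported back.
    have h := hΦ.indep_count _ (fun i => f ⁻¹' {((f.range.equivFin.symm i : f.range) : ℝ≥0∞)})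
      (fun i => f.measurableSet_preimage _) (by
        intro i j hij
        refine Disjoint.preimage _ (Set.disjoint_singleton.2 fun h => hij ?_)
        exact f.range.equivFin.symm.injective (Subtype.ext h))
    have h' := h.precomp f.range.equivFin.injective
    simpa using h'
  have hcomp := hind.comp (fun c x => Real.exp (-((c : ℝ≥0∞).toReal * x.toReal)))
    (fun c => by fun_prop)
  simp_rw [h1]
  refine (hcomp.integral_fun_prod_eq_prod_integral fun c => ?_).trans ?_
  · have := hΦ.measurable_count _ (f.measurableSet_preimage {(c : ℝ≥0∞)})
    simp only [Function.comp_def]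
    exact Measurable.aestronglyMeasurable (by fun_prop)
  · rw [h2, ← Finset.sum_neg_distrib, Real.exp_sum]
    exact Finset.prod_congr rfl fun c _ =>
      hΦ.integral_exp_neg_mul_count (f.measurableSet_preimage _) _

lemma IsPoissonProcess.measurable_lintegral (hΦ : IsPoissonProcess Φ Λ P) {f : S → ℝ≥0∞}
    (hf : Measurable f) : Measurable fun ω => ∫⁻ x, f x ∂(Φ ω) := by
  have h : Measurable Φ := Measure.measurable_of_measurable_coe _ hΦ.measurable_count
  exact (Measure.measurable_lintegral hf).comp h

/-- The Laplace functional of a Poisson process. -/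
theorem IsPoissonProcess.integral_exp_neg_lintegral [IsFiniteMeasure Λ] [IsProbabilityMeasure P]
    [∀ ω, IsFiniteMeasure (Φ ω)] (hΦ : IsPoissonProcess Φ Λ P) {f : S → ℝ≥0∞}
    (hf : Measurable f) (hfin : ∀ x, f x ≠ ∞) (hint : ∀ ω, ∫⁻ x, f x ∂(Φ ω) ≠ ∞) :
    ∫ ω, Real.exp (-(∫⁻ x, f x ∂(Φ ω)).toReal) ∂P =
      Real.exp (-∫ x, (1 - Real.exp (-(f x).toReal)) ∂Λ) := by
  -- Both sides pass to the limit along simple approximations from below: monotone convergence for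
  -- each `ω`, where finiteness of the limit makes `toReal` continuous, then dominated convergence
  -- with bound `1`.
  have hl : Tendsto (fun n => ∫ ω, Real.exp (-(∫⁻ x, SimpleFunc.eapprox f n x ∂(Φ ω)).toReal) ∂P)
      atTop (𝓝 (∫ ω, Real.exp (-(∫⁻ x, f x ∂(Φ ω)).toReal) ∂P)) := by
    refine tendsto_integral_of_dominated_convergence (fun _ => 1) (fun n => ?_)
      (integrable_const _) (fun n => ?_) ?_
    · have := hΦ.measurable_lintegral (SimpleFunc.eapprox f n).measurable
      exact Measurable.aestronglyMeasurable (by fun_prop)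
    · refine ae_of_all _ fun ω => ?_
      rw [Real.norm_eq_abs, abs_of_pos (Real.exp_pos _), Real.exp_le_one_iff]
      simp
    · refine ae_of_all _ fun ω => ?_
      have h := lintegral_tendsto_of_tendsto_of_monotone (μ := Φ ω)
        (f := fun n x => SimpleFunc.eapprox f n x) (F := f)
        (fun n => (SimpleFunc.eapprox f n).measurable.aemeasurable)
        (ae_of_all _ fun x => fun _ _ hnm => SimpleFunc.monotone_eapprox f hnm x)
        (ae_of_all _ fun x => SimpleFunc.tendsto_eapprox hf x)
      exact (Real.continuous_exp.tendsto _).comp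
        (((ENNReal.tendsto_toReal (hint ω)).comp h).neg)
  have hr : Tendsto (fun n => ∫ x, (1 - Real.exp (-(SimpleFunc.eapprox f n x).toReal)) ∂Λ)
      atTop (𝓝 (∫ x, (1 - Real.exp (-(f x).toReal)) ∂Λ)) := by
    refine tendsto_integral_of_dominated_convergence (fun _ => 1) (fun n => ?_)
      (integrable_const _) (fun n => ?_) ?_
    · have := (SimpleFunc.eapprox f n).measurable
      exact Measurable.aestronglyMeasurable (by fun_prop)
    · refine ae_of_all _ fun x => ?_
      have h1 := Real.exp_pos (-(SimpleFunc.eapprox f n x).toReal)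
      have h2 : Real.exp (-(SimpleFunc.eapprox f n x).toReal) ≤ 1 :=
        Real.exp_le_one_iff.2 (by simp)
      rw [Real.norm_eq_abs, abs_le]
      constructor <;> linarith
    · exact ae_of_all _ fun x => (Real.continuous_exp.tendsto _).comp
        (((ENNReal.tendsto_toReal (hfin x)).comp (SimpleFunc.tendsto_eapprox hf x)).neg)
        |>.const_sub 1
  refine tendsto_nhds_unique hl ?_
  simp_rw [fun n => hΦ.integral_exp_neg_simpleFunc (SimpleFunc.eapprox f n)
    (fun x => (SimpleFunc.eapprox_lt_top f n x).ne)]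
  exact (Real.continuous_exp.tendsto _).comp hr.neg

lemma lintegral_countingMeasure (n : ℕ) (x : ℕ → Plane) {f : Plane → ℝ≥0∞} (hf : Measurable f) :
    ∫⁻ z, f z ∂(countingMeasure n x) = ∑ i ∈ Finset.range n, f (x i) := by
  simp [countingMeasure, lintegral_finsetSum_measure, lintegral_dirac' _ hf]

instance (n : ℕ) (x : ℕ → Plane) : IsFiniteMeasure (countingMeasure n x) := by
  unfold countingMeasure
  infer_instance

/-- The probability generating functional of a Poisson process with finitely many points. -/
theorem IsPoissonProcess.integral_prod [IsProbabilityMeasure P] {Λ : Measure Plane}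
    [IsFiniteMeasure Λ] {N : Ω → ℕ} {X : ℕ → Ω → Plane}
    (hΦ : IsPoissonProcess (fun ω => countingMeasure (N ω) (fun i => X i ω)) Λ P)
    {φ : Plane → ℝ} (hφ : Measurable φ) (hpos : ∀ x, 0 < φ x) (hle : ∀ x, φ x ≤ 1) :
    ∫ ω, ∏ i ∈ Finset.range (N ω), φ (X i ω) ∂P = Real.exp (-∫ x, (1 - φ x) ∂Λ) := by
  -- The choice `f = -log φ` makes the product the exponential of minus a sum over the points; `0 <
  -- φ ≤ 1` makes `f` finite and nonnegative.
  have hf : Measurable fun x => ENNReal.ofReal (-Real.log (φ x)) := by fun_prop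
  have h1 : ∀ x, (ENNReal.ofReal (-Real.log (φ x))).toReal = -Real.log (φ x) := fun x =>
    ENNReal.toReal_ofReal (neg_nonneg.2 (Real.log_nonpos (hpos x).le (hle x)))
  have h := hΦ.integral_exp_neg_lintegral hf (fun x => ENNReal.ofReal_ne_top) (fun ω => by
    rw [lintegral_countingMeasure _ _ hf]
    exact ENNReal.sum_ne_top.2 fun _ _ => ENNReal.ofReal_ne_top)
  simp_rw [lintegral_countingMeasure _ _ hf, h1, neg_neg, Real.exp_log (hpos _)] at h
  rw [← h]
  refine integral_congr_ae (ae_of_all _ fun ω => ?_)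
  simp only
  rw [ENNReal.toReal_sum (fun _ _ => ENNReal.ofReal_ne_top), ← Finset.sum_neg_distrib,
    Real.exp_sum]
  exact Finset.prod_congr rfl fun i _ => by rw [h1, neg_neg, Real.exp_log (hpos _)]

end LaplaceFunctional

/-! ### Interference: exponential fading, independence and thinning. -/

section Interference

lemma abs_indicator_one_le_one {A : Type*} (S : Set A) (a : A) :
    |S.indicator (fun _ => (1 : ℝ)) a| ≤ 1 := by
  by_cases h : a ∈ S <;> simp [h]

lemma measurable_indicator_Ici :
    Measurable ((Set.Ici (0 : ℝ)).indicator fun _ => (1 : ℝ)) :=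
  measurable_const.indicator measurableSet_Ici

/-! ### The unit-mean exponential law -/

lemma integral_expMeasure_one (g : ℝ → ℝ) :
    ∫ x, g x ∂(expMeasure 1) = ∫ x in Set.Ioi 0, Real.exp (-x) * g x := by
  have hm : Measurable (gammaPDF 1 1) := (measurable_gammaPDFReal 1 1).ennreal_ofReal
  rw [expMeasure, gammaMeasure, integral_withDensity_eq_integral_toReal_smul hm
    (ae_of_all _ fun x => ENNReal.ofReal_lt_top), ← integral_Ici_eq_integral_Ioi,
    ← integral_indicator measurableSet_Ici]
  refine integral_congr_ae (ae_of_all _ fun x => ?_)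
  by_cases hx : 0 ≤ x
  · simp [gammaPDF, gammaPDFReal, hx, (Real.exp_pos (-x)).le]
  · simp [gammaPDF, gammaPDFReal, hx]

instance : IsProbabilityMeasure (expMeasure 1) := isProbabilityMeasure_expMeasure one_pos

lemma ae_pos_expMeasure_one : ∀ᵐ x ∂(expMeasure 1), 0 < x := by
  have h : ∫ x, (Set.Iic (0 : ℝ)).indicator (fun _ => (1 : ℝ)) x ∂(expMeasure 1) = 0 := by
    rw [integral_expMeasure_one]
    refine integral_eq_zero_of_ae ?_
    filter_upwards [ae_restrict_mem measurableSet_Ioi] with x hx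
    have : ¬ x ≤ 0 := not_le.2 hx
    simp [this]
  rw [integral_indicator_const _ measurableSet_Iic, smul_eq_mul, mul_one,
    measureReal_eq_zero_iff] at h
  filter_upwards [compl_mem_ae_iff.2 h] with x hx
  simpa using hx

lemma integral_exp_neg_mul_abs_expMeasure_one {t : ℝ} (ht : 0 ≤ t) :
    ∫ x, Real.exp (-(t * |x|)) ∂(expMeasure 1) = 1 / (1 + t) := by
  rw [integral_expMeasure_one]
  have h : ∫ x in Set.Ioi (0 : ℝ), Real.exp (-x) * Real.exp (-(t * |x|)) =
      ∫ x in Set.Ioi (0 : ℝ), Real.exp (-(1 + t) * x) := by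
    refine setIntegral_congr_fun measurableSet_Ioi fun x hx => ?_
    simp only [abs_of_pos (Set.mem_Ioi.1 hx), ← Real.exp_add]
    ring_nf
  rw [h, integral_exp_mul_Ioi (by linarith)]
  simp only [mul_zero, Real.exp_zero]
  rw [neg_div_neg_eq]

/-- This is the exponential tail; `0 ≤ t` places `[t, ∞)` inside the support of the law. -/
lemma integral_indicator_sub_expMeasure_one {t : ℝ} (ht : 0 ≤ t) :
    ∫ x, (Set.Ici 0).indicator (fun _ => (1 : ℝ)) (x - t) ∂(expMeasure 1) = Real.exp (-t) := by
  rw [integral_expMeasure_one, ← integral_exp_neg_Ioi t, ← integral_Ici_eq_integral_Ioi (x := t),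
    ← integral_Ici_eq_integral_Ioi,
    ← integral_indicator measurableSet_Ici, ← integral_indicator measurableSet_Ici]
  refine integral_congr_ae (ae_of_all _ fun x => ?_)
  by_cases hx : t ≤ x
  · simp [hx, ht.trans hx]
  · simp [hx]

/-! ### Independence -/

variable {Ω : Type*} [MeasurableSpace Ω] {P : Measure Ω}

/-- Fubini for the product law: one variable may be frozen while the other is averaged. It is used
to freeze the nodes, and to freeze the interference. -/
lemma IndepFun.integral_comp_prodMk [IsProbabilityMeasure P] {A B : Type*} [MeasurableSpace A]
    [MeasurableSpace B] {X : Ω → A} {Y : Ω → B} (h : IndepFun X Y P) (hX : AEMeasurable X P)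
    (hY : AEMeasurable Y P) {F : A × B → ℝ} (hF : Measurable F) {C : ℝ}
    (hC : ∀ z, |F z| ≤ C) :
    ∫ ω, F (X ω, Y ω) ∂P = ∫ ω', ∫ ω, F (X ω', Y ω) ∂P ∂P := by
  have : IsProbabilityMeasure (P.map X) := Measure.isProbabilityMeasure_map hX
  have : IsProbabilityMeasure (P.map Y) := Measure.isProbabilityMeasure_map hY
  have hint : Integrable F ((P.map X).prod (P.map Y)) :=
    Integrable.of_bound hF.aestronglyMeasurable C (ae_of_all _ hC)
  have h1 : ∀ a, ∫ b, F (a, b) ∂(P.map Y) = ∫ ω, F (a, Y ω) ∂P := fun a =>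
    integral_map hY (hF.comp measurable_prodMk_left).aestronglyMeasurable
  rw [← integral_map (φ := fun ω => (X ω, Y ω)) (hX.prodMk hY) hF.aestronglyMeasurable,
    (indepFun_iff_map_prod_eq_prod_map_map hX hY).1 h, integral_prod _ hint,
    integral_map hX hint.1.integral_prod_right']
  simp_rw [h1]

/-- Each function sees only finitely many coordinates, so it factors through restriction to its
finite block followed by extension by zero. Independence of disjoint finite blocks then applies. -/
lemma iIndepFun.indepFun_of_dependsOn {ι : Type*} {f : ι → Ω → ℝ} (h : iIndepFun f P)
    (hf : ∀ i, AEMeasurable (f i) P) {S T : Finset ι} (hST : Disjoint S T)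
    {F G : (ι → ℝ) → ℝ} (hF : Measurable F) (hG : Measurable G) (hFS : DependsOn F S)
    (hGT : DependsOn G T) :
    IndepFun (fun ω => F (fun k => f k ω)) (fun ω => G (fun k => f k ω)) P := by
  classical
  have hm : ∀ S : Finset ι, Measurable
      (fun (v : S → ℝ) (k : ι) => if hk : k ∈ S then v ⟨k, hk⟩ else 0) := by
    intro S
    refine measurable_pi_iff.2 fun k => ?_
    by_cases hk : k ∈ S
    · simpa [hk] using measurable_pi_apply _
    · simp [hk]
  have h1 := (h.indepFun_finset₀ S T hST hf).comp (hF.comp (hm S)) (hG.comp (hm T))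
  convert! h1 using 1
  · ext ω
    exact hFS fun k hk => by simp [Finset.mem_coe.1 hk]
  · ext ω
    exact hGT fun k hk => by simp [Finset.mem_coe.1 hk]

/-- With `J` frozen, the inner mean is the exponential tail at `J`. This is where Rayleigh fading
turns a success probability into a Laplace transform. -/
lemma IndepFun.integral_indicator_sub [IsProbabilityMeasure P] {J g : Ω → ℝ} (h : IndepFun J g P)
    (hJ : AEMeasurable J P) (hg : HasLaw g (expMeasure 1) P) (hpos : ∀ ω, 0 ≤ J ω) :
    ∫ ω, (Set.Ici 0).indicator (fun _ => (1 : ℝ)) (g ω - J ω) ∂P = ∫ ω, Real.exp (-J ω) ∂P := by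
  have hm : Measurable fun z : ℝ × ℝ => (Set.Ici 0).indicator (fun _ => (1 : ℝ)) (z.2 - z.1) :=
    measurable_indicator_Ici.comp (measurable_snd.sub measurable_fst)
  have h1 := IndepFun.integral_comp_prodMk h hJ hg.aemeasurable hm (C := 1)
    (fun z => abs_indicator_one_le_one _ _)
  refine h1.trans (integral_congr_ae (ae_of_all _ fun ω' => ?_))
  have h2 := hg.integral_comp (f := fun x => (Set.Ici 0).indicator (fun _ => (1 : ℝ)) (x - J ω'))
    (hm.comp measurable_prodMk_left).aestronglyMeasurable
  rw [integral_indicator_sub_expMeasure_one (hpos ω')] at h2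
  exact h2

/-! ### Thinning and the interference -/

open Classical in
/-- The contribution to the interference at `y` of a node at `x` with mark `u` and fading `g`. -/
noncomputable def contribution (pol : Policy) (α R₁ R₂ : ℝ) (y x : Plane) (u g : ℝ) : ℝ :=
  if IsJammer pol α R₁ R₂ x u then |g| * ‖x - y‖ ^ (-α) else 0

/-- The probability that a node at distance `r` from the transmitter is a jammer. -/
noncomputable def jamProb (pol : Policy) (α R₁ R₂ r : ℝ) : ℝ :=
  if r ≤ R₁ then 1 else if r ≤ R₂ then pol.prob α R₁ R₂ r else 0

/-- The interference of the first `n` nodes of a configuration, as a function of all marks. -/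
noncomputable def markedInterference (pol : Policy) (α R₁ R₂ : ℝ) (y : Plane) (n : ℕ)
    (x : ℕ → Plane) (m : ℕ ⊕ ℕ ⊕ Unit → ℝ) : ℝ :=
  ∑ i ∈ Finset.range n,
    contribution pol α R₁ R₂ y (x i) (m (Sum.inl i)) (m (Sum.inr (Sum.inl i)))

variable {pol : Policy} {α R₁ R₂ : ℝ} {y : Plane}

lemma measurable_prob : Measurable fun r => pol.prob α R₁ R₂ r := by
  cases pol <;> simp only [Policy.prob] <;> fun_prop

lemma measurableSet_isJammer :
    MeasurableSet {z : Plane × ℝ | IsJammer pol α R₁ R₂ z.1 z.2} := by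
  have hp : Measurable fun z : Plane × ℝ => pol.prob α R₁ R₂ ‖z.1‖ :=
    measurable_prob.comp (measurable_norm.comp measurable_fst)
  refine (measurableSet_le (measurable_norm.comp measurable_fst) measurable_const).union ?_
  exact (measurableSet_lt measurable_const (measurable_norm.comp measurable_fst)).inter
    ((measurableSet_le (measurable_norm.comp measurable_fst) measurable_const).inter
      (measurableSet_le measurable_snd hp))

lemma measurable_contribution :
    Measurable fun z : Plane × ℝ × ℝ => contribution pol α R₁ R₂ y z.1 z.2.1 z.2.2 := by
  refine Measurable.ite ?_ (by fun_prop) measurable_const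
  exact measurableSet_isJammer.preimage (f := fun z : Plane × ℝ × ℝ => (z.1, z.2.1))
    (by fun_prop)

lemma contribution_nonneg (x : Plane) (u g : ℝ) : 0 ≤ contribution pol α R₁ R₂ y x u g := by
  unfold contribution
  split_ifs <;> positivity

lemma markedInterference_nonneg (n : ℕ) (x : ℕ → Plane) (m : ℕ ⊕ ℕ ⊕ Unit → ℝ) :
    0 ≤ markedInterference pol α R₁ R₂ y n x m :=
  Finset.sum_nonneg fun _ _ => contribution_nonneg _ _ _

lemma markedInterference_succ (n : ℕ) (x : ℕ → Plane) (m : ℕ ⊕ ℕ ⊕ Unit → ℝ) :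
    markedInterference pol α R₁ R₂ y (n + 1) x m = markedInterference pol α R₁ R₂ y n x m +
      contribution pol α R₁ R₂ y (x n) (m (Sum.inl n)) (m (Sum.inr (Sum.inl n))) :=
  Finset.sum_range_succ _ _

lemma measurable_markedInterference :
    Measurable fun z : (ℕ × (ℕ → Plane)) × (ℕ ⊕ ℕ ⊕ Unit → ℝ) =>
      markedInterference pol α R₁ R₂ y z.1.1 z.1.2 z.2 := by
  have h : Measurable fun z : ℕ × ((ℕ → Plane) × (ℕ ⊕ ℕ ⊕ Unit → ℝ)) =>
      markedInterference pol α R₁ R₂ y z.1 z.2.1 z.2.2 := by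
    refine measurable_from_prod_countable_right fun n => ?_
    simp only [markedInterference]
    refine Finset.measurable_fun_sum _ fun i _ => ?_
    exact measurable_contribution.comp (f := fun z : (ℕ → Plane) × (ℕ ⊕ ℕ ⊕ Unit → ℝ) =>
      (z.1 i, z.2 (Sum.inl i), z.2 (Sum.inr (Sum.inl i)))) (by fun_prop)
  exact h.comp (f := fun z : (ℕ × (ℕ → Plane)) × (ℕ ⊕ ℕ ⊕ Unit → ℝ) =>
    (z.1.1, z.1.2, z.2)) (by fun_prop)

/-- The marks of the first `n` nodes. -/
def markIndices (n : ℕ) : Finset (ℕ ⊕ ℕ ⊕ Unit) :=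
  (Finset.range n).disjSum ((Finset.range n).disjSum ∅)

lemma dependsOn_markedInterference (n : ℕ) (x : ℕ → Plane) :
    DependsOn (markedInterference pol α R₁ R₂ y n x) (markIndices n) := by
  intro m m' h
  refine Finset.sum_congr rfl fun i hi => ?_
  rw [h (Sum.inl i) (by simpa [markIndices] using hi),
    h (Sum.inr (Sum.inl i)) (by simpa [markIndices] using hi)]

lemma measurable_jamProb : Measurable fun r => jamProb pol α R₁ R₂ r :=
  Measurable.ite measurableSet_Iic measurable_const
    (Measurable.ite measurableSet_Iic measurable_prob measurable_const)

lemma jamProb_mem_Icc (hprob : ∀ r, R₁ < r → r ≤ R₂ → pol.prob α R₁ R₂ r ∈ Set.Icc (0 : ℝ) 1)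
    (r : ℝ) : jamProb pol α R₁ R₂ r ∈ Set.Icc (0 : ℝ) 1 := by
  unfold jamProb
  split_ifs with h1 h2
  · simp
  · exact hprob r (not_le.1 h1) h2
  · simp

lemma integral_indicator_uniform {q : ℝ} (hq : q ∈ Set.Icc (0 : ℝ) 1) :
    ∫ u in Set.Icc (0 : ℝ) 1, (Set.Iic q).indicator (fun _ => (1 : ℝ)) u = q := by
  rw [setIntegral_indicator measurableSet_Iic, setIntegral_const,
    show Set.Icc (0 : ℝ) 1 ∩ Set.Iic q = Set.Icc 0 q by
      ext u; simp only [Set.mem_inter_iff, Set.mem_Icc, Set.mem_Iic]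
      exact ⟨fun h => ⟨h.1.1, h.2⟩, fun h => ⟨⟨h.1, h.2.trans hq.2⟩, h.2⟩⟩]
  simp [hq.1]

lemma integral_isJammer
    (hprob : ∀ r, R₁ < r → r ≤ R₂ → pol.prob α R₁ R₂ r ∈ Set.Icc (0 : ℝ) 1) (x : Plane) :
    ∫ u in Set.Icc (0 : ℝ) 1, {v | IsJammer pol α R₁ R₂ x v}.indicator (fun _ => (1 : ℝ)) u =
      jamProb pol α R₁ R₂ ‖x‖ := by
  unfold jamProb
  split_ifs with h1 h2
  · simp [IsJammer, h1]
  · simp only [IsJammer, h1, h2, not_le.1 h1, false_or, true_and]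
    exact integral_indicator_uniform (hprob _ (not_le.1 h1) h2)
  · simp [IsJammer, h1, h2]

/-- The Laplace transform of the contribution of a node at `x`. -/
noncomputable def nodeLaplace (pol : Policy) (α R₁ R₂ s : ℝ) (y x : Plane) : ℝ :=
  1 - jamProb pol α R₁ R₂ ‖x‖ * (1 - 1 / (1 + s * ‖x - y‖ ^ (-α)))

lemma measurable_nodeLaplace (s : ℝ) : Measurable fun x => nodeLaplace pol α R₁ R₂ s y x := by
  have : Measurable fun x : Plane => jamProb pol α R₁ R₂ ‖x‖ :=
    measurable_jamProb.comp measurable_norm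
  unfold nodeLaplace
  fun_prop

lemma nodeLaplace_mem_Ioc
    (hprob : ∀ r, R₁ < r → r ≤ R₂ → pol.prob α R₁ R₂ r ∈ Set.Icc (0 : ℝ) 1)
    {s : ℝ} (hs : 0 ≤ s) (x : Plane) : nodeLaplace pol α R₁ R₂ s y x ∈ Set.Ioc (0 : ℝ) 1 := by
  obtain ⟨h0, h1⟩ := jamProb_mem_Icc hprob ‖x‖
  have hc : 0 ≤ s * ‖x - y‖ ^ (-α) := by positivity
  have h2 : 0 < 1 / (1 + s * ‖x - y‖ ^ (-α)) := by positivity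
  have h3 : 1 / (1 + s * ‖x - y‖ ^ (-α)) ≤ 1 := by
    rw [div_le_one (by positivity)]; linarith
  unfold nodeLaplace
  constructor <;> nlinarith

lemma abs_one_sub_exp_neg_le_one {t : ℝ} (ht : 0 ≤ t) : |1 - Real.exp (-t)| ≤ 1 := by
  have h1 := Real.exp_pos (-t)
  have h2 : Real.exp (-t) ≤ 1 := Real.exp_le_one_iff.2 (by linarith)
  rw [abs_le]
  constructor <;> linarith

lemma integral_one_sub_exp_neg_mul_abs {t : ℝ} (ht : 0 ≤ t) :
    ∫ x, (1 - Real.exp (-(t * |x|))) ∂(expMeasure 1) = 1 - 1 / (1 + t) := by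
  rw [integral_sub (integrable_const _), integral_exp_neg_mul_abs_expMeasure_one ht]
  · simp
  · refine Integrable.of_bound (C := 1) (Measurable.aestronglyMeasurable (by fun_prop))
      (ae_of_all _ fun x => ?_)
    rw [Real.norm_eq_abs, abs_of_pos (Real.exp_pos _), Real.exp_le_one_iff]
    have := mul_nonneg ht (abs_nonneg x)
    linarith

lemma IndepFun.integral_one_sub_mul [IsProbabilityMeasure P] {U g : Ω → ℝ} (h : IndepFun U g P)
    (hU : AEMeasurable U P) (hg : AEMeasurable g P) {a b : ℝ → ℝ} (ha : Measurable a)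
    (hb : Measurable b) (ha1 : ∀ u, |a u| ≤ 1) (hb1 : ∀ t, |b t| ≤ 1) :
    ∫ ω, (1 - a (U ω) * b (g ω)) ∂P = 1 - (∫ ω, a (U ω) ∂P) * ∫ ω, b (g ω) ∂P := by
  rw [integral_sub (integrable_const _), h.integral_fun_comp_mul_comp hU hg
      ha.aestronglyMeasurable hb.aestronglyMeasurable]
  · simp
  · refine Integrable.of_bound (C := 1) ?_ (ae_of_all _ fun ω => ?_)
    · exact ((ha.comp_aemeasurable hU).mul (hb.comp_aemeasurable hg)).aestronglyMeasurable
    · rw [norm_mul]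
      exact mul_le_one₀ (ha1 _) (norm_nonneg _) (hb1 _)

lemma measurableSet_isJammer_mark (x : Plane) :
    MeasurableSet {v : ℝ | IsJammer pol α R₁ R₂ x v} := by
  have h := measurable_prodMk_left (x := x)
    (measurableSet_isJammer (pol := pol) (α := α) (R₁ := R₁) (R₂ := R₂))
  exact h

/-- The exponential takes the value `1` off the jamming event, so it is affine in the indicator of
that event. This separates mark from fading, whose means then multiply. -/
lemma exp_neg_mul_contribution (s : ℝ) (x : Plane) (u t : ℝ) :
    Real.exp (-(s * contribution pol α R₁ R₂ y x u t)) =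
      1 - {v | IsJammer pol α R₁ R₂ x v}.indicator (fun _ => (1 : ℝ)) u *
        (1 - Real.exp (-(s * ‖x - y‖ ^ (-α) * |t|))) := by
  by_cases hj : IsJammer pol α R₁ R₂ x u
  · have h : u ∈ {v | IsJammer pol α R₁ R₂ x v} := hj
    rw [contribution, if_pos hj, Set.indicator_of_mem h, one_mul, sub_sub_cancel]
    congr 2
    ring
  · have h : u ∉ {v | IsJammer pol α R₁ R₂ x v} := hj
    rw [contribution, if_neg hj, Set.indicator_of_notMem h]
    simp

lemma integral_exp_neg_contribution [IsProbabilityMeasure P] {U g : Ω → ℝ}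
    (hUg : IndepFun U g P) (hU : HasLaw U (volume.restrict (Set.Icc (0 : ℝ) 1)) P)
    (hg : HasLaw g (expMeasure 1) P)
    (hprob : ∀ r, R₁ < r → r ≤ R₂ → pol.prob α R₁ R₂ r ∈ Set.Icc (0 : ℝ) 1)
    {s : ℝ} (hs : 0 ≤ s) (x : Plane) :
    ∫ ω, Real.exp (-(s * contribution pol α R₁ R₂ y x (U ω) (g ω))) ∂P =
      nodeLaplace pol α R₁ R₂ s y x := by
  have hc : 0 ≤ s * ‖x - y‖ ^ (-α) :=
    mul_nonneg hs (Real.rpow_nonneg (norm_nonneg _) _)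
  have ha : Measurable ({v | IsJammer pol α R₁ R₂ x v}.indicator (fun _ => (1 : ℝ))) :=
    measurable_const.indicator (measurableSet_isJammer_mark x)
  have hb : Measurable fun t : ℝ => 1 - Real.exp (-(s * ‖x - y‖ ^ (-α) * |t|)) := by fun_prop
  have h2 := IndepFun.integral_one_sub_mul hUg hU.aemeasurable hg.aemeasurable ha hb
    (fun u => abs_indicator_one_le_one _ u)
    (fun t => abs_one_sub_exp_neg_le_one (mul_nonneg hc (abs_nonneg t)))
  have hIa := (hU.integral_comp ha.aestronglyMeasurable).trans (integral_isJammer hprob x)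
  have hIb := (hg.integral_comp hb.aestronglyMeasurable).trans
    (integral_one_sub_exp_neg_mul_abs hc)
  simp only [Function.comp_def] at hIa hIb
  simp_rw [exp_neg_mul_contribution]
  rw [h2, hIa, hIb, nodeLaplace]

/-! ### Laplace transform of the interference and outage probability of the network. -/

namespace IsNetwork

variable {lam D : ℝ} {N : Ω → ℕ} {X : ℕ → Ω → Plane} {U h : ℕ → Ω → ℝ} {h₀ : Ω → ℝ}

lemma aemeasurable_marks (hnet : IsNetwork P lam D N X U h h₀) (k : ℕ ⊕ ℕ ⊕ Unit) :
    AEMeasurable (Sum.elim U (Sum.elim h (fun _ : Unit => h₀)) k) P := by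
  rcases k with i | i | i
  · exact (hnet.law_mark i).aemeasurable
  · exact (hnet.law_fading i).aemeasurable
  · exact hnet.law_fading_zero.aemeasurable

/-- The modulus of the fading in `contribution` makes the interference nonnegative everywhere, which
gives uniform bounds for Fubini. Since the fadings are almost surely positive, it changes nothing
almost surely. -/
lemma interference_ae_eq (hnet : IsNetwork P lam D N X U h h₀) :
    interference pol α R₁ R₂ N X U h y =ᵐ[P] fun ω => markedInterference pol α R₁ R₂ y (N ω)
      (fun i => X i ω) (fun k => Sum.elim U (Sum.elim h (fun _ : Unit => h₀)) k ω) := by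
  have hpos : ∀ᵐ ω ∂P, ∀ i, 0 < h i ω := ae_all_iff.2 fun i =>
    ((hnet.law_fading i).ae_iff (p := fun x : ℝ => 0 < x)
      (measurableSet_setOfPred.1 measurableSet_Ioi)).2 ae_pos_expMeasure_one
  filter_upwards [hpos] with ω hω
  simp only [interference, markedInterference, contribution, Finset.sum_filter]
  refine Finset.sum_congr rfl fun i _ => ?_
  simp only [Sum.elim_inl, Sum.elim_inr, abs_of_pos (hω i)]
  congr

/-- By induction on `n`: the mark and fading of node `n` lie outside `markIndices n`, so its factor
splits off by independence. -/
lemma integral_exp_neg_markedInterference [IsProbabilityMeasure P]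
    (hnet : IsNetwork P lam D N X U h h₀)
    (hprob : ∀ r, R₁ < r → r ≤ R₂ → pol.prob α R₁ R₂ r ∈ Set.Icc (0 : ℝ) 1)
    {s : ℝ} (hs : 0 ≤ s) (n : ℕ) (x : ℕ → Plane) :
    ∫ ω, Real.exp (-(s * markedInterference pol α R₁ R₂ y n x
      (fun k => Sum.elim U (Sum.elim h (fun _ : Unit => h₀)) k ω))) ∂P =
      ∏ i ∈ Finset.range n, nodeLaplace pol α R₁ R₂ s y (x i) := by
  induction n with
  | zero => simp [markedInterference]
  | succ n ih =>
    have hm : ∀ n, Measurable (markedInterference pol α R₁ R₂ y n x) := fun n =>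
      measurable_markedInterference.comp
        (f := fun m : ℕ ⊕ ℕ ⊕ Unit → ℝ => ((n, x), m)) (by fun_prop)
    have hF : Measurable fun m => Real.exp (-(s * markedInterference pol α R₁ R₂ y n x m)) := by
      have := hm n
      fun_prop
    have hG : Measurable fun m : ℕ ⊕ ℕ ⊕ Unit → ℝ => Real.exp (-(s *
        contribution pol α R₁ R₂ y (x n) (m (Sum.inl n)) (m (Sum.inr (Sum.inl n))))) := by
      have := measurable_contribution (pol := pol) (α := α) (R₁ := R₁) (R₂ := R₂) (y := y) |>.comp
        (f := fun m : ℕ ⊕ ℕ ⊕ Unit → ℝ => (x n, m (Sum.inl n), m (Sum.inr (Sum.inl n))))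
        (by fun_prop)
      simp only [Function.comp_def] at this
      fun_prop
    have hST : Disjoint (markIndices n)
        ({Sum.inl n, Sum.inr (Sum.inl n)} : Finset (ℕ ⊕ ℕ ⊕ Unit)) := by
      simp [markIndices]
    have hind := iIndepFun.indepFun_of_dependsOn hnet.indep_marks hnet.aemeasurable_marks hST
      hF hG (fun m m' hmm => by
        simp only [dependsOn_markedInterference (pol := pol) (α := α) (R₁ := R₁) (R₂ := R₂)
          (y := y) n x hmm])
      (fun m m' hmm => by
        simp only [hmm (Sum.inl n) (by simp), hmm (Sum.inr (Sum.inl n)) (by simp)])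
    have hmarks := aemeasurable_pi_iff.2 hnet.aemeasurable_marks
    have h1 := hind.integral_fun_mul_eq_mul_integral
      (hF.comp_aemeasurable hmarks).aestronglyMeasurable
      (hG.comp_aemeasurable hmarks).aestronglyMeasurable
    have hUh : IndepFun (U n) (h n) P :=
      hnet.indep_marks.indepFun (i := Sum.inl n) (j := Sum.inr (Sum.inl n)) (by simp)
    rw [Finset.prod_range_succ, ← ih, ← integral_exp_neg_contribution hUh (hnet.law_mark n)
      (hnet.law_fading n) hprob hs (x n)]
    refine Eq.trans ?_ h1
    refine integral_congr_ae (ae_of_all _ fun ω => ?_)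
    simp only
    rw [← Real.exp_add, markedInterference_succ]
    congr 1
    ring

/-- The desired link has its own index, outside `markIndices n`, so its fading is independent of the
interference of a frozen configuration. -/
lemma integral_indicator_sub_markedInterference [IsProbabilityMeasure P]
    (hnet : IsNetwork P lam D N X U h h₀) {s : ℝ} (hs : 0 ≤ s) (n : ℕ) (x : ℕ → Plane) :
    ∫ ω, (Set.Ici 0).indicator (fun _ => (1 : ℝ)) (h₀ ω -
      s * markedInterference pol α R₁ R₂ y n x
        (fun k => Sum.elim U (Sum.elim h (fun _ : Unit => h₀)) k ω)) ∂P =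
    ∫ ω, Real.exp (-(s * markedInterference pol α R₁ R₂ y n x
      (fun k => Sum.elim U (Sum.elim h (fun _ : Unit => h₀)) k ω))) ∂P := by
  have hF : Measurable fun m => s * markedInterference pol α R₁ R₂ y n x m :=
    (measurable_markedInterference.comp
      (f := fun m : ℕ ⊕ ℕ ⊕ Unit → ℝ => ((n, x), m)) (by fun_prop)).const_mul s
  have hind := iIndepFun.indepFun_of_dependsOn hnet.indep_marks hnet.aemeasurable_marks
    (S := markIndices n) (T := {Sum.inr (Sum.inr ())}) (by simp [markIndices])
    hF (measurable_pi_apply (Sum.inr (Sum.inr ())))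
    (fun m m' hmm => by
      simp only [dependsOn_markedInterference (pol := pol) (α := α) (R₁ := R₁) (R₂ := R₂)
        (y := y) n x hmm])
    (fun m m' hmm => hmm _ (by simp))
  exact IndepFun.integral_indicator_sub hind
    (hF.comp_aemeasurable (aemeasurable_pi_iff.2 hnet.aemeasurable_marks))
    hnet.law_fading_zero (fun ω => mul_nonneg hs (markedInterference_nonneg _ _ _))

lemma aemeasurable_nodes (hnet : IsNetwork P lam D N X U h h₀) :
    AEMeasurable (fun ω => (N ω, fun i => X i ω)) P :=
  (hnet.measurable_num.prodMk (measurable_pi_iff.2 hnet.measurable_node)).aemeasurable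

lemma laplaceTransform_eq_integral_integral [IsProbabilityMeasure P]
    (hnet : IsNetwork P lam D N X U h h₀) {s : ℝ} (hs : 0 ≤ s) :
    laplaceTransform P (interference pol α R₁ R₂ N X U h y) s =
      ∫ ω', ∫ ω, Real.exp (-(s * markedInterference pol α R₁ R₂ y (N ω') (fun i => X i ω')
        (fun k => Sum.elim U (Sum.elim h (fun _ : Unit => h₀)) k ω))) ∂P ∂P := by
  have hF : Measurable fun z : (ℕ × (ℕ → Plane)) × (ℕ ⊕ ℕ ⊕ Unit → ℝ) =>
      Real.exp (-(s * markedInterference pol α R₁ R₂ y z.1.1 z.1.2 z.2)) := by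
    have := measurable_markedInterference (pol := pol) (α := α) (R₁ := R₁) (R₂ := R₂) (y := y)
    fun_prop
  rw [laplaceTransform, ← IndepFun.integral_comp_prodMk hnet.indep_nodes_marks
    hnet.aemeasurable_nodes (aemeasurable_pi_iff.2 hnet.aemeasurable_marks) hF (C := 1)
    (fun z => ?_)]
  · refine integral_congr_ae ?_
    filter_upwards [hnet.interference_ae_eq] with ω hω
    exact congrArg (fun J => Real.exp (-(s * J))) hω
  · rw [abs_of_pos (Real.exp_pos _), Real.exp_le_one_iff, neg_nonpos]
    exact mul_nonneg hs (markedInterference_nonneg _ _ _)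

/-- The Laplace transform of the interference. -/
theorem laplaceTransform_eq [IsProbabilityMeasure P] (hnet : IsNetwork P lam D N X U h h₀)
    (hprob : ∀ r, R₁ < r → r ≤ R₂ → pol.prob α R₁ R₂ r ∈ Set.Icc (0 : ℝ) 1)
    (hlam : 0 ≤ lam) {s : ℝ} (hs : 0 ≤ s) :
    laplaceTransform P (interference pol α R₁ R₂ N X U h y) s =
      Real.exp (-(lam * ∫ x in Metric.closedBall (0 : Plane) D,
        jamProb pol α R₁ R₂ ‖x‖ * (1 - 1 / (1 + s * ‖x - y‖ ^ (-α))))) := by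
  have : IsFiniteMeasure (ENNReal.ofReal lam • volume.restrict (Metric.closedBall (0 : Plane) D)) :=
    have : IsFiniteMeasure (volume.restrict (Metric.closedBall (0 : Plane) D)) :=
      isFiniteMeasure_restrict.2 measure_closedBall_lt_top.ne
    Measure.smul_finite _ ENNReal.ofReal_ne_top
  rw [hnet.laplaceTransform_eq_integral_integral hs]
  rw [integral_congr_ae (ae_of_all _ fun ω =>
    hnet.integral_exp_neg_markedInterference (y := y) hprob hs (N ω) (fun i => X i ω)), hnet.poisson.integral_prod (measurable_nodeLaplace s)
    (fun x => (nodeLaplace_mem_Ioc hprob hs x).1) (fun x => (nodeLaplace_mem_Ioc hprob hs x).2),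
    integral_smul_measure, ENNReal.toReal_ofReal hlam, smul_eq_mul]
  simp only [nodeLaplace, sub_sub_cancel]

/-- When `J = 0` the ratio is `∞` and both sides fail; otherwise this is clearing denominators. -/
lemma sir_lt_iff {l g J β : ℝ} (hl : 0 < l) (hg : 0 < g) (hJ : 0 ≤ J) (hβ : 0 < β) :
    sir α l g J < ENNReal.ofReal β ↔ ¬ β * l ^ α * J ≤ g := by
  have hla : 0 < l ^ α := Real.rpow_pos_of_pos hl α
  have hgl : 0 < g * l ^ (-α) := mul_pos hg (Real.rpow_pos_of_pos hl _)
  unfold sir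
  rcases hJ.eq_or_lt with rfl | hJ
  · rw [ENNReal.ofReal_zero, ENNReal.div_zero (by simpa using hgl)]
    simp [hg.le]
  · rw [← ENNReal.ofReal_div_of_pos hJ, ENNReal.ofReal_lt_ofReal_iff hβ, not_le, div_lt_iff₀ hJ,
      Real.rpow_neg hl.le, ← div_eq_mul_inv, div_lt_iff₀ hla]
    ring_nf

/-- The transmission outage probability in terms of the Laplace transform. -/
theorem transmissionOutage_eq [IsProbabilityMeasure P] (hnet : IsNetwork P lam D N X U h h₀)
    (hy : 0 < ‖y‖) {β : ℝ} (hβ : 0 < β) :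
    transmissionOutage P pol α R₁ R₂ N X U h h₀ y β =
      1 - laplaceTransform P (interference pol α R₁ R₂ N X U h y) (β * ‖y‖ ^ α) := by
  have hs : 0 ≤ β * ‖y‖ ^ α := by positivity
  have hF : Measurable fun z : (ℕ × (ℕ → Plane)) × (ℕ ⊕ ℕ ⊕ Unit → ℝ) =>
      (Set.Ici 0).indicator (fun _ => (1 : ℝ)) (z.2 (Sum.inr (Sum.inr ())) -
        β * ‖y‖ ^ α * markedInterference pol α R₁ R₂ y z.1.1 z.1.2 z.2) := by
    have := measurable_markedInterference (pol := pol) (α := α) (R₁ := R₁) (R₂ := R₂) (y := y)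
    exact measurable_indicator_Ici.comp (by fun_prop)
  have hfub := IndepFun.integral_comp_prodMk hnet.indep_nodes_marks
    hnet.aemeasurable_nodes (aemeasurable_pi_iff.2 hnet.aemeasurable_marks) hF (C := 1)
    (fun z => abs_indicator_one_le_one _ _)
  simp only [Sum.elim_inr] at hfub
  rw [integral_congr_ae (μ := P) (ae_of_all _ fun ω =>
    hnet.integral_indicator_sub_markedInterference (pol := pol) (α := α) (R₁ := R₁) (R₂ := R₂) (y := y)
      hs (N ω) (fun i => X i ω)), ← hnet.laplaceTransform_eq_integral_integral hs] at hfub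
  have hpos : ∀ᵐ ω ∂P, 0 < h₀ ω := (hnet.law_fading_zero.ae_iff (p := fun x : ℝ => 0 < x)
      (measurableSet_setOfPred.1 measurableSet_Ioi)).2 ae_pos_expMeasure_one
  have hFP := hF.comp_aemeasurable (hnet.aemeasurable_nodes.prodMk
    (aemeasurable_pi_iff.2 hnet.aemeasurable_marks))
  set E := {ω | sir α ‖y‖ (h₀ ω) (interference pol α R₁ R₂ N X U h y ω) < ENNReal.ofReal β}
    with hE
  have hEF : E.indicator (fun _ => (1 : ℝ)) =ᵐ[P] fun ω => 1 -
      (Set.Ici 0).indicator (fun _ => (1 : ℝ)) (h₀ ω - β * ‖y‖ ^ α *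
        markedInterference pol α R₁ R₂ y (N ω) (fun i => X i ω)
          (fun k => Sum.elim U (Sum.elim h (fun _ : Unit => h₀)) k ω)) := by
    filter_upwards [hpos, hnet.interference_ae_eq (pol := pol) (α := α) (R₁ := R₁) (R₂ := R₂)
      (y := y)] with ω hω hI
    have h1 := sir_lt_iff (α := α) hy hω (markedInterference_nonneg (pol := pol) (α := α)
      (R₁ := R₁) (R₂ := R₂) (y := y) (N ω) (fun i => X i ω)
        (fun k => Sum.elim U (Sum.elim h (fun _ : Unit => h₀)) k ω)) hβ
    simp only [Set.indicator_apply, hE, Set.mem_ofPred_eq, hI, h1, Set.mem_Ici, sub_nonneg]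
    split_ifs <;> simp_all
  -- Marks and fadings are only almost everywhere measurable, so measurability of the outage event
  -- is read off from its indicator, which agrees almost everywhere with an a.e.-measurable
  -- function.
  have hEm : NullMeasurableSet E P := by
    have h1 : AEMeasurable (E.indicator fun _ => (1 : ℝ)) P :=
      (hFP.const_sub 1).congr hEF.symm
    exact (aemeasurable_indicator_const_iff (1 : ℝ)).1 h1
  have hE1 : P.real E = ∫ ω, E.indicator (fun _ => (1 : ℝ)) ω ∂P := by
    rw [integral_indicator₀ hEm]
    simp
  rw [transmissionOutage, hE1, integral_congr_ae hEF, integral_sub (integrable_const _)]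
  · rw [hfub]
    simp
  · exact Integrable.of_bound (C := 1) hFP.aestronglyMeasurable
      (ae_of_all _ fun ω => abs_indicator_one_le_one _ _)

end IsNetwork

end Interference

/-! ### Angular integral -/

open Complex in
lemma one_sub_mul_ne_zero {ρ z : ℂ} (hρ : ‖ρ‖ < 1) (hz : ‖z‖ ≤ 1) : 1 - ρ * z ≠ 0 := by
  intro h
  have h2 : ‖ρ‖ * ‖z‖ = 1 := by rw [← norm_mul, ← sub_eq_zero.1 h, norm_one]
  nlinarith [norm_nonneg ρ, norm_nonneg z]

open Complex in
-- Cauchy's formula at `ρ`: the pole `1 / ρ` of the second factor is outside the closed unit disk.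
lemma circleIntegral_sub_inv_mul_one_sub_mul_inv {ρ : ℂ} (hρ : ‖ρ‖ < 1) :
    ∮ z in C(0, 1), (z - ρ)⁻¹ * (1 - ρ * z)⁻¹ = 2 * Real.pi * I * (1 - ρ ^ 2)⁻¹ := by
  have hd : DiffContOnCl ℂ (fun z : ℂ => (1 - ρ * z)⁻¹) (Metric.ball 0 1) := by
    refine DifferentiableOn.diffContOnCl_ball (U := Metric.closedBall 0 1) ?_ subset_rfl
    intro z hz
    refine DifferentiableAt.differentiableWithinAt (DifferentiableAt.inv (by fun_prop) ?_)
    exact one_sub_mul_ne_zero hρ (by simpa using hz)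
  have hC := hd.circleIntegral_sub_inv_smul (w := ρ) (by simpa using hρ)
  simp only [smul_eq_mul, ← sq] at hC
  exact hC

open Complex in
-- Substituting `z = exp (iθ)`, `cos θ = (z + 1/z) / 2` makes the denominator a quadratic in `z`
-- divided by `z`. The relation `hquad` says that the roots of the quadratic are `ρ` and `1 / ρ`.
lemma inv_sub_mul_cos_eq {A ρ : ℂ} {B : ℝ} (hB : 0 < B) (hρ0 : ρ ≠ 0) (hρ : ‖ρ‖ < 1)
    (hquad : B * (1 + ρ ^ 2) = 2 * A * ρ) (θ : ℝ) :
    (A - B * Real.cos θ)⁻¹ = 2 * ρ / (B * I) * (deriv (circleMap 0 1) θ •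
      ((circleMap 0 1 θ - ρ)⁻¹ * (1 - ρ * circleMap 0 1 θ)⁻¹)) := by
  have hBc : (B : ℂ) ≠ 0 := by exact_mod_cast hB.ne'
  rw [deriv_circleMap, smul_eq_mul]
  have hz : circleMap 0 1 θ ≠ 0 := circleMap_ne_center one_ne_zero
  have hz1 : ‖circleMap 0 1 θ‖ = 1 := by simp
  have hcos : (Real.cos θ : ℂ) * (2 * circleMap 0 1 θ) = circleMap 0 1 θ ^ 2 + 1 := by
    have h1 : cexp (θ * I) * cexp (-θ * I) = 1 := by rw [← Complex.exp_add]; simp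
    rw [ofReal_cos, Complex.cos, circleMap_zero, ofReal_one, one_mul]
    linear_combination h1
  generalize circleMap 0 1 θ = z at *
  have h2 : z - ρ ≠ 0 := by
    intro h
    rw [sub_eq_zero.1 h] at hz1
    exact hρ.ne hz1
  have h3 := one_sub_mul_ne_zero hρ hz1.le
  have h4 : A - B * Real.cos θ = B * (1 - ρ * z) * (z - ρ) / (2 * ρ * z) := by
    rw [eq_div_iff (mul_ne_zero (mul_ne_zero two_ne_zero hρ0) hz)]
    linear_combination (-z) * hquad - B * ρ * hcos
  rw [h4]
  field_simp

open Complex in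
/-- `∫ dθ / (A - B cos θ) = 2π / w` over a period, where `w` is the square root of `A² - B²` on the
side of `A`. -/
lemma integral_inv_sub_mul_cos {A w : ℂ} {B : ℝ} (hB : 0 < B) (hw : w ^ 2 = A ^ 2 - B ^ 2)
    (hre : 0 < (A * (starRingEnd ℂ) w).re) :
    ∫ θ in (-Real.pi)..Real.pi, (A - B * Real.cos θ)⁻¹ = 2 * Real.pi / w := by
  have hBc : (B : ℂ) ≠ 0 := by exact_mod_cast hB.ne'
  have hw0 : w ≠ 0 := by
    rintro rfl
    simp at hre
  -- This is a root of `B z² - 2 A z + B`; the other root is `(A + w) / B`.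
  obtain ⟨ρ, hρ⟩ : ∃ ρ : ℂ, ρ = (A - w) / B := ⟨_, rfl⟩
  have hAw : (A - w) * (A + w) = B ^ 2 := by linear_combination -hw
  have hρ0 : ρ ≠ 0 := by
    rw [hρ]
    refine div_ne_zero (fun h => ?_) hBc
    rw [h, zero_mul] at hAw
    exact pow_ne_zero 2 hBc hAw.symm
  have hquad : B * (1 + ρ ^ 2) = 2 * A * ρ := by
    rw [hρ]
    field_simp
    linear_combination hw
  have hρw : B * (1 - ρ ^ 2) = 2 * ρ * w := by
    rw [hρ]
    field_simp
    linear_combination hw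
  have hlt : ‖ρ‖ < 1 := by
    -- `hre` is the cross term of the two squared norms. As the product of the norms is `B²`, the
    -- smaller one is below `B`.
    have h1 : ‖A - w‖ < ‖A + w‖ := by
      rw [← sq_lt_sq₀ (norm_nonneg _) (norm_nonneg _), ← normSq_eq_norm_sq, ← normSq_eq_norm_sq,
        normSq_sub, normSq_add]
      linarith
    have h2 : ‖A - w‖ * ‖A + w‖ = B ^ 2 := by
      rw [← norm_mul, hAw, norm_pow, norm_real, Real.norm_of_nonneg hB.le]
    rw [hρ, norm_div, norm_real, Real.norm_of_nonneg hB.le, div_lt_one hB]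
    nlinarith [norm_nonneg (A - w)]
  have hper : Function.Periodic (fun θ : ℝ => (A - B * Real.cos θ)⁻¹) (2 * Real.pi) := by
    intro θ
    simp only [Real.cos_add_two_pi]
  have hshift := hper.intervalIntegral_add_eq (-Real.pi) 0
  rw [show -Real.pi + 2 * Real.pi = Real.pi by ring, zero_add] at hshift
  have hC := circleIntegral_sub_inv_mul_one_sub_mul_inv hlt
  rw [circleIntegral] at hC
  rw [hshift, intervalIntegral.integral_congr
    (fun θ _ => inv_sub_mul_cos_eq hB hρ0 hlt hquad θ),
    intervalIntegral.integral_const_mul, hC]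
  have hρ2 : 1 - ρ ^ 2 = 2 * ρ * w / B := by
    rw [eq_div_iff hBc]
    linear_combination hρw
  rw [hρ2]
  field_simp

/-! ### Polar coordinates about the transmitter -/

/-- After identifying the plane with `ℂ`, a rotation by the argument of `y` puts the receiver on the
positive real axis, so that the angle at the origin is the polar angle. -/
lemma exists_isometry_map_eq (y : Plane) :
    ∃ T : ℂ ≃ₗᵢ[ℝ] Plane, T (‖y‖ : ℂ) = y := by
  set T₀ := Complex.orthonormalBasisOneI.repr with hT₀
  refine ⟨(rotation (Circle.exp (T₀.symm y).arg)).trans T₀, ?_⟩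
  rw [LinearIsometryEquiv.trans_apply, rotation_apply, Circle.coe_exp,
    ← LinearIsometryEquiv.norm_map T₀.symm y, mul_comm, Complex.norm_mul_exp_arg_mul_I,
    LinearIsometryEquiv.apply_symm_apply]

lemma norm_polarCoord_symm_sub_sq (r θ l : ℝ) :
    ‖Complex.polarCoord.symm (r, θ) - l‖ ^ 2 = r ^ 2 + l ^ 2 - 2 * r * l * Real.cos θ := by
  rw [← Complex.normSq_eq_norm_sq, Complex.polarCoord_symm_apply, Complex.normSq_apply]
  simp only [Complex.sub_re, Complex.sub_im, Complex.mul_re, Complex.mul_im, Complex.add_re,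
    Complex.add_im, Complex.ofReal_re, Complex.ofReal_im, Complex.I_re, Complex.I_im]
  linear_combination r ^ 2 * Real.sin_sq_add_cos_sq θ

/-- An integral over a disk about the origin of a function of the distances to the origin and to
`y`, in polar coordinates. -/
lemma setIntegral_closedBall_eq_polar (y : Plane) {q G : ℝ → ℝ} (hq : Measurable q)
    (hG : Measurable G) {C₁ C₂ : ℝ} (hqC : ∀ r, |q r| ≤ C₁) (hGC : ∀ u, 0 ≤ u → |G u| ≤ C₂)
    {D : ℝ} (hD : 0 ≤ D) :
    ∫ x in Metric.closedBall (0 : Plane) D, q ‖x‖ * G (‖x - y‖ ^ 2) =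
      ∫ r in (0)..D, q r * (r * ∫ θ in (-Real.pi)..Real.pi,
        G (r ^ 2 + ‖y‖ ^ 2 - 2 * r * ‖y‖ * Real.cos θ)) := by
  obtain ⟨T, hT⟩ := exists_isometry_map_eq y
  set k : ℝ × ℝ → ℝ := fun p =>
    p.1 * (q p.1 * G (p.1 ^ 2 + ‖y‖ ^ 2 - 2 * p.1 * ‖y‖ * Real.cos p.2)) with hk
  have h1 : ∫ x in Metric.closedBall (0 : Plane) D, q ‖x‖ * G (‖x - y‖ ^ 2) =
      ∫ z in Metric.closedBall (0 : ℂ) D, q ‖z‖ * G (‖z - ‖y‖‖ ^ 2) := by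
    rw [← T.measurePreserving.setIntegral_preimage_emb
      T.toHomeomorph.measurableEmbedding]
    have : T ⁻¹' Metric.closedBall (0 : Plane) D = Metric.closedBall 0 D := by
      ext z; simp
    rw [this]
    refine setIntegral_congr_fun measurableSet_closedBall fun z _ => ?_
    have h2 : ‖T z - y‖ = ‖z - ‖y‖‖ := by
      conv_lhs => rw [← hT]
      rw [← map_sub, LinearIsometryEquiv.norm_map]
    simp only [LinearIsometryEquiv.norm_map, h2]
  have h2 : ∫ z in Metric.closedBall (0 : ℂ) D, q ‖z‖ * G (‖z - ‖y‖‖ ^ 2) =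
      ∫ p in Set.Ioc 0 D ×ˢ Set.Ioo (-Real.pi) Real.pi, k p := by
    rw [← integral_indicator measurableSet_closedBall, ← Complex.integral_comp_polarCoord_symm,
      show Set.Ioc 0 D ×ˢ Set.Ioo (-Real.pi) Real.pi =
        (Set.Ioi 0 ×ˢ Set.Ioo (-Real.pi) Real.pi) ∩ (Set.Iic D ×ˢ Set.univ) by
          ext p; simp only [Set.mem_prod, Set.mem_inter_iff, Set.mem_Ioc, Set.mem_Ioi,
            Set.mem_Iic, Set.mem_univ]; tauto,
      ← setIntegral_indicator (measurableSet_Iic.prod MeasurableSet.univ)]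
    refine setIntegral_congr_fun polarCoord.open_target.measurableSet fun p hp => ?_
    have hp0 : 0 < p.1 := hp.1
    have hn : ‖Complex.polarCoord.symm p‖ = p.1 := by
      rw [Complex.norm_polarCoord_symm, abs_of_pos hp0]
    by_cases hD' : p.1 ≤ D
    · rw [Set.indicator_of_mem (by rw [mem_closedBall_zero_iff, hn]; exact hD'),
        Set.indicator_of_mem (by simpa using hD'), hn, norm_polarCoord_symm_sub_sq p.1 p.2,
        smul_eq_mul]
    · rw [Set.indicator_of_notMem (by rw [mem_closedBall_zero_iff, hn]; exact hD'),
        Set.indicator_of_notMem (by simpa using hD'), smul_zero]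
  have hint : IntegrableOn k (Set.Ioc 0 D ×ˢ Set.Ioo (-Real.pi) Real.pi)
      (volume.prod volume) := by
    have hfin : (volume.prod volume) (Set.Ioc 0 D ×ˢ Set.Ioo (-Real.pi) Real.pi) ≠ ∞ := by
      rw [Measure.prod_prod]
      exact ENNReal.mul_ne_top (by simp) (by simp)
    have hkm : Measurable k := by fun_prop
    refine Measure.integrableOn_of_bounded (M := D * (C₁ * C₂)) hfin hkm.aestronglyMeasurable ?_
    filter_upwards [ae_restrict_mem (measurableSet_Ioc.prod measurableSet_Ioo)] with p hp
    -- The bound on `G` is available only for nonnegative arguments; by the law of cosines this one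
    -- is a squared distance.
    have hu : 0 ≤ p.1 ^ 2 + ‖y‖ ^ 2 - 2 * p.1 * ‖y‖ * Real.cos p.2 := by
      rw [← norm_polarCoord_symm_sub_sq]; positivity
    simp only [hk, Real.norm_eq_abs, abs_mul, abs_of_pos hp.1.1]
    have hC₁ : 0 ≤ C₁ := (abs_nonneg _).trans (hqC 0)
    gcongr
    · exact hp.1.2
    · exact hqC _
    · exact hGC _ hu
  rw [h1, h2, Measure.volume_eq_prod, setIntegral_prod _ hint,
    intervalIntegral.integral_of_le hD]
  refine setIntegral_congr_fun measurableSet_Ioc fun r _ => ?_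
  simp only [hk]
  rw [intervalIntegral.integral_of_le (by linarith [Real.pi_pos]), integral_Ioc_eq_integral_Ioo,
    ← integral_const_mul, ← integral_const_mul]
  refine integral_congr_ae (ae_of_all _ fun θ => ?_)
  ring

/-! ### Radial integral -/

/-- The integral of the jammer density against a radial function. -/
lemma integral_jamProb_mul {pol : Policy} {α R₁ R₂ D : ℝ} (hR₁ : 0 ≤ R₁) (hR₁₂ : R₁ ≤ R₂)
    (hR₂ : R₂ ≤ D) {k : ℝ → ℝ} (hk : Continuous k)
    (hc : ContinuousOn (fun r => pol.prob α R₁ R₂ r) (Set.Icc R₁ R₂)) :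
    ∫ r in (0)..D, jamProb pol α R₁ R₂ r * k r =
      (∫ r in (0)..R₁, k r) + ∫ r in R₁..R₂, pol.prob α R₁ R₂ r * k r := by
  have e1 : Set.EqOn (fun r => jamProb pol α R₁ R₂ r * k r) k (Set.uIoc 0 R₁) := by
    intro r hr
    rw [Set.uIoc_of_le hR₁] at hr
    simp [jamProb, hr.2]
  have e2 : Set.EqOn (fun r => jamProb pol α R₁ R₂ r * k r)
      (fun r => pol.prob α R₁ R₂ r * k r) (Set.uIoc R₁ R₂) := by
    intro r hr
    rw [Set.uIoc_of_le hR₁₂] at hr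
    simp [jamProb, hr.2, not_le.2 hr.1]
  have e3 : Set.EqOn (fun r => jamProb pol α R₁ R₂ r * k r) (fun _ => 0) (Set.uIoc R₂ D) := by
    intro r hr
    rw [Set.uIoc_of_le hR₂] at hr
    simp [jamProb, not_le.2 hr.1, not_le.2 (hR₁₂.trans_lt hr.1)]
  have i1 : IntervalIntegrable (fun r => jamProb pol α R₁ R₂ r * k r) volume 0 R₁ :=
    (intervalIntegrable_congr e1).2 (hk.intervalIntegrable _ _)
  have i2 : IntervalIntegrable (fun r => jamProb pol α R₁ R₂ r * k r) volume R₁ R₂ :=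
    (intervalIntegrable_congr e2).2 (ContinuousOn.intervalIntegrable (by
      rw [Set.uIcc_of_le hR₁₂]
      exact hc.mul hk.continuousOn))
  have i3 : IntervalIntegrable (fun r => jamProb pol α R₁ R₂ r * k r) volume R₂ D :=
    (intervalIntegrable_congr e3).2 (by simp)
  rw [← intervalIntegral.integral_add_adjacent_intervals (i1.trans i2) i3,
    ← intervalIntegral.integral_add_adjacent_intervals i1 i2,
    intervalIntegral.integral_congr_ae (ae_of_all _ e1), intervalIntegral.integral_congr_ae (ae_of_all _ e2),
    intervalIntegral.integral_congr_ae (ae_of_all _ e3)]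
  simp

lemma Policy.prob_mem_Icc {pol : Policy} {α R₁ R₂ : ℝ} (hα : 0 < α) (hR₁ : 0 < R₁)
    (hpol : pol = .I ∨ pol = .D → R₁ < R₂) (r : ℝ) (h₁ : R₁ < r) (h₂ : r ≤ R₂) :
    pol.prob α R₁ R₂ r ∈ Set.Icc (0 : ℝ) 1 := by
  have h1 : R₁ ^ α < r ^ α := Real.rpow_lt_rpow hR₁.le h₁ hα
  have h2 : r ^ α ≤ R₂ ^ α := Real.rpow_le_rpow (hR₁.trans h₁).le h₂ hα.le
  have h3 : 0 < R₂ ^ α - R₁ ^ α := by linarith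
  cases pol with
  | E p => exact p.2
  | I =>
    simp only [Policy.prob]
    exact ⟨div_nonneg (by linarith) h3.le, (div_le_one h3).2 (by linarith)⟩
  | D =>
    simp only [Policy.prob]
    exact ⟨div_nonneg (by linarith) h3.le, (div_le_one h3).2 (by linarith)⟩

lemma Policy.continuousOn_prob {pol : Policy} {α R₁ R₂ : ℝ} (hα : 0 ≤ α) {S : Set ℝ} :
    ContinuousOn (fun r => pol.prob α R₁ R₂ r) S := by
  have h : Continuous fun r : ℝ => r ^ α := Real.continuous_rpow_const hα
  cases pol <;> simp only [Policy.prob] <;> fun_prop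

/-- The integral of the jammer density against `k`, in terms of antiderivatives `V₀` of `k` and
`V₁` of `r ^ m * k r`. -/
noncomputable def radialValue (m : ℕ) (V₀ V₁ : ℝ → ℝ) (R₁ R₂ : ℝ) : Policy → ℝ
  | .E p => V₀ R₁ - V₀ 0 + p * (V₀ R₂ - V₀ R₁)
  | .I => V₀ R₁ - V₀ 0 +
      ((V₁ R₂ - V₁ R₁) - R₁ ^ m * (V₀ R₂ - V₀ R₁)) / (R₂ ^ m - R₁ ^ m)
  | .D => V₀ R₁ - V₀ 0 +
      (R₂ ^ m * (V₀ R₂ - V₀ R₁) - (V₁ R₂ - V₁ R₁)) / (R₂ ^ m - R₁ ^ m)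

lemma integral_jamProb_mul_eq_radialValue {pol : Policy} {m : ℕ} {R₁ R₂ D : ℝ} (hR₁ : 0 ≤ R₁)
    (hR₁₂ : R₁ ≤ R₂) (hR₂ : R₂ ≤ D) {k V₀ V₁ : ℝ → ℝ} (hk : Continuous k)
    (hV₀ : ∀ r, HasDerivAt V₀ (k r) r) (hV₁ : ∀ r, HasDerivAt V₁ (r ^ m * k r) r) :
    ∫ r in (0)..D, jamProb pol m R₁ R₂ r * k r = radialValue m V₀ V₁ R₁ R₂ pol := by
  have hi₀ : ∀ a b, ∫ r in a..b, k r = V₀ b - V₀ a := fun a b =>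
    intervalIntegral.integral_eq_sub_of_hasDerivAt (fun r _ => hV₀ r) (hk.intervalIntegrable _ _)
  have hk' : Continuous fun r => r ^ m * k r := by fun_prop
  have hi₁ : ∀ a b, ∫ r in a..b, r ^ m * k r = V₁ b - V₁ a := fun a b =>
    intervalIntegral.integral_eq_sub_of_hasDerivAt (fun r _ => hV₁ r) (hk'.intervalIntegrable _ _)
  -- Policies I and D have selection probabilities affine in `r ^ m`, so each is covered by one
  -- choice of `u` and `v`.
  have hlin : ∀ u v : ℝ, ∫ r in R₁..R₂, (u * (r ^ m * k r) + v * k r) =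
      u * (V₁ R₂ - V₁ R₁) + v * (V₀ R₂ - V₀ R₁) := by
    intro u v
    rw [intervalIntegral.integral_add ((hk'.const_mul u).intervalIntegrable _ _)
      ((hk.const_mul v).intervalIntegrable _ _), intervalIntegral.integral_const_mul,
      intervalIntegral.integral_const_mul, hi₀, hi₁]
  rw [integral_jamProb_mul hR₁ hR₁₂ hR₂ hk (Policy.continuousOn_prob (Nat.cast_nonneg m)), hi₀]
  cases pol with
  | E p =>
    simp only [Policy.prob, radialValue]
    rw [intervalIntegral.integral_const_mul, hi₀]
  | I =>
    simp only [Policy.prob, radialValue, Real.rpow_natCast]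
    rw [intervalIntegral.integral_congr (g := fun r => (R₂ ^ m - R₁ ^ m)⁻¹ * (r ^ m * k r) +
      (-(R₁ ^ m) / (R₂ ^ m - R₁ ^ m)) * k r) (fun r _ => by simp only; ring), hlin]
    ring
  | D =>
    simp only [Policy.prob, radialValue, Real.rpow_natCast]
    rw [intervalIntegral.integral_congr (g := fun r => (-(R₂ ^ m - R₁ ^ m)⁻¹) * (r ^ m * k r) +
      (R₂ ^ m / (R₂ ^ m - R₁ ^ m)) * k r) (fun r _ => by simp only; ring), hlin]
    ring

/-- The Laplace transform of the interference for an even path loss exponent `m = 2 j`, given the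
angular integral of the kernel `s / (s + u ^ j)` of the squared distance `u` to the receiver and
its radial antiderivatives. -/
lemma IsNetwork.laplaceTransform_eq_radialValue {Ω : Type*} [MeasurableSpace Ω] {P : Measure Ω}
    [IsProbabilityMeasure P] {lam D R₁ R₂ : ℝ} (hlam : 0 < lam) (hR₁ : 0 < R₁) (hR₁₂ : R₁ ≤ R₂)
    (hR₂ : R₂ ≤ D) {pol : Policy} (hpol : pol = .I ∨ pol = .D → R₁ < R₂) {y : Plane}
    {N : Ω → ℕ} {X : ℕ → Ω → Plane} {U h : ℕ → Ω → ℝ} {h₀ : Ω → ℝ}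
    (hnet : IsNetwork P lam D N X U h h₀) {j : ℕ} (hj : 0 < j) {s : ℝ} (hs : 0 < s)
    {k V₀ V₁ : ℝ → ℝ} (hk : Continuous k) (hV₀ : ∀ r, HasDerivAt V₀ (k r) r)
    (hV₁ : ∀ r, HasDerivAt V₁ (r ^ (2 * j) * k r) r)
    (hang : ∀ r, 0 < r → ∫ θ in (-Real.pi)..Real.pi,
      s / (s + (r ^ 2 + ‖y‖ ^ 2 - 2 * r * ‖y‖ * Real.cos θ) ^ j) = k r / r) :
    laplaceTransform P (interference pol ((2 * j : ℕ) : ℝ) R₁ R₂ N X U h y) s =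
      Real.exp (-(lam * radialValue (2 * j) V₀ V₁ R₁ R₂ pol)) := by
  have hα : (0 : ℝ) < ((2 * j : ℕ) : ℝ) := by positivity
  have hprob := Policy.prob_mem_Icc hα hR₁ hpol
  have hD : 0 ≤ D := (hR₁.le.trans hR₁₂).trans hR₂
  -- At `x = y` the identity fails: `0 ^ (-α)` is `0` by convention, so the left side is `0` and the
  -- right side is `1`. A single point is a null set.
  have hpt : ∀ x : Plane, x ≠ y → 1 - 1 / (1 + s * ‖x - y‖ ^ (-((2 * j : ℕ) : ℝ))) =
      s / (s + (‖x - y‖ ^ 2) ^ j) := by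
    intro x hx
    have hn : 0 < ‖x - y‖ := norm_pos_iff.2 (sub_ne_zero.2 hx)
    rw [Real.rpow_neg hn.le, Real.rpow_natCast, ← pow_mul]
    have hn' : 0 < ‖x - y‖ ^ (2 * j) := by positivity
    field_simp
    ring
  have hint : ∫ x in Metric.closedBall (0 : Plane) D, jamProb pol ((2 * j : ℕ) : ℝ) R₁ R₂ ‖x‖ *
      (1 - 1 / (1 + s * ‖x - y‖ ^ (-((2 * j : ℕ) : ℝ)))) =
      ∫ x in Metric.closedBall (0 : Plane) D, jamProb pol ((2 * j : ℕ) : ℝ) R₁ R₂ ‖x‖ *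
        (s / (s + (‖x - y‖ ^ 2) ^ j)) := by
    have hne : ∀ᵐ x : Plane, x ≠ y := by simp [ae_iff]
    refine integral_congr_ae ?_
    filter_upwards [ae_restrict_of_ae hne] with x hx
    rw [hpt x hx]
  rw [hnet.laplaceTransform_eq hprob hlam.le hs.le, hint,
    setIntegral_closedBall_eq_polar y (G := fun u => s / (s + u ^ j)) (C₁ := 1) (C₂ := 1)
      measurable_jamProb (by fun_prop) (fun r => ?_) (fun u hu => ?_) hD]
  · rw [← integral_jamProb_mul_eq_radialValue hR₁.le hR₁₂ hR₂ hk hV₀ hV₁]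
    congr 3
    refine intervalIntegral.integral_congr_ae (ae_of_all _ fun r hr => ?_)
    rw [Set.uIoc_of_le hD] at hr
    -- The polar Jacobian `r` cancels the `1 / r` in the angular integral.
    rw [hang r hr.1, mul_div_cancel₀ _ hr.1.ne']
  · obtain ⟨h0, h1⟩ := jamProb_mem_Icc hprob r
    rwa [abs_of_nonneg h0]
  · have : 0 ≤ u ^ j := by positivity
    rw [abs_of_nonneg (by positivity), div_le_one (by positivity)]
    linarith

/-! ### Path loss exponent 2 -/

section Exponent2

variable {s l : ℝ}

/-- The radicand equals `(s + r² - l²)² + 4 l² s`. The same identity turns the square root in the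
derivative of `arsinh` into `rad`. -/
lemma rad_pos (hs : 0 < s) (hl : 0 < l) (r : ℝ) : 0 < rad r s l := by
  refine Real.sqrt_pos.2 ?_
  have : 0 < l ^ 2 * s := by positivity
  nlinarith [sq_nonneg (s + r ^ 2 - l ^ 2)]

lemma rad_sq (hs : 0 < s) (hl : 0 < l) (r : ℝ) :
    rad r s l ^ 2 = r ^ 4 + 2 * (s - l ^ 2) * r ^ 2 + (s + l ^ 2) ^ 2 :=
  Real.sq_sqrt (Real.sqrt_pos.1 (rad_pos hs hl r)).le

lemma hasDerivAt_rad (hs : 0 < s) (hl : 0 < l) (r : ℝ) :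
    HasDerivAt (fun r => rad r s l) (2 * r * (r ^ 2 + s - l ^ 2) / rad r s l) r := by
  have h : HasDerivAt (fun r => r ^ 4 + 2 * (s - l ^ 2) * r ^ 2 + (s + l ^ 2) ^ 2)
      (4 * r ^ 3 + 2 * (s - l ^ 2) * (2 * r)) r := by
    have h4 := hasDerivAt_pow 4 r
    have h2 := hasDerivAt_pow 2 r
    convert! (h4.add (h2.const_mul (2 * (s - l ^ 2)))).add_const ((s + l ^ 2) ^ 2) using 1
    norm_num
  have h' := h.sqrt (Real.sqrt_pos.1 (rad_pos hs hl r)).ne'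
  convert! h' using 1
  have := (rad_pos hs hl r).ne'
  rw [← rad]
  field_simp
  ring

lemma hasDerivAt_ash (hs : 0 < s) (hl : 0 < l) (r : ℝ) :
    HasDerivAt (fun r => ash r s l) (2 * r / rad r s l) r := by
  have h : HasDerivAt (fun r => (s + r ^ 2 - l ^ 2) / (2 * l * √s)) (2 * r / (2 * l * √s)) r := by
    have h2 := hasDerivAt_pow 2 r
    convert! ((h2.const_add s).sub_const (l ^ 2)).div_const (2 * l * √s) using 1
    norm_num
  have h' := h.arsinh
  have hss : 0 < √s := Real.sqrt_pos.2 hs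
  have hsq : √s ^ 2 = s := Real.sq_sqrt hs.le
  have hrad := rad_pos hs hl r
  have hroot : √(1 + ((s + r ^ 2 - l ^ 2) / (2 * l * √s)) ^ 2) = rad r s l / (2 * l * √s) := by
    rw [Real.sqrt_eq_iff_mul_self_eq (by positivity) (by positivity), ← sq, div_pow, div_pow,
      rad_sq hs hl, mul_pow, hsq]
    field_simp
    ring
  convert! h' using 1
  rw [hroot]
  simp only [smul_eq_mul]
  field_simp

/-- `sinh (log t) = (t - 1/t) / 2` at `t = √s / l`. This is the contribution of the lower endpoint
of the radial integral. -/
lemma ash_zero (hs : 0 < s) (hl : 0 < l) : ash 0 s l = Real.log (√s / l) := by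
  have hss : 0 < √s := Real.sqrt_pos.2 hs
  have hsq : √s ^ 2 = s := Real.sq_sqrt hs.le
  rw [ash, ← Real.arsinh_sinh (Real.log (√s / l)), Real.sinh_eq, Real.exp_neg,
    Real.exp_log (by positivity)]
  congr 1
  field_simp
  rw [hsq]
  ring

/-- The angular formula with `A = s + r² + l²` and `B = 2 r l`, for which `A² - B²` is `rad²`. -/
lemma integral_kernel_two (hs : 0 < s) (hl : 0 < l) {r : ℝ} (hr : 0 < r) :
    ∫ θ in (-Real.pi)..Real.pi, s / (s + (r ^ 2 + l ^ 2 - 2 * r * l * Real.cos θ) ^ 1) =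
      2 * Real.pi * s * r / rad r s l / r := by
  have hrad := rad_pos hs hl r
  have hw : ((rad r s l : ℝ) : ℂ) ^ 2 =
      ((s + r ^ 2 + l ^ 2 : ℝ) : ℂ) ^ 2 - ((2 * r * l : ℝ) : ℂ) ^ 2 := by
    norm_cast
    rw [rad_sq hs hl]
    ring
  have h := integral_inv_sub_mul_cos (A := ((s + r ^ 2 + l ^ 2 : ℝ) : ℂ))
    (w := ((rad r s l : ℝ) : ℂ)) (B := 2 * r * l) (by positivity) hw (by
      rw [Complex.conj_ofReal, ← Complex.ofReal_mul, Complex.ofReal_re]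
      positivity)
  have h1 : ∀ θ : ℝ, (((s + r ^ 2 + l ^ 2 : ℝ) : ℂ) - (2 * r * l : ℝ) * Real.cos θ)⁻¹ =
      (((s + (r ^ 2 + l ^ 2 - 2 * r * l * Real.cos θ) ^ 1)⁻¹ : ℝ) : ℂ) := by
    intro θ
    push_cast
    ring
  rw [intervalIntegral.integral_congr (fun θ _ => h1 θ), intervalIntegral.integral_ofReal] at h
  have h2 : ∫ θ in (-Real.pi)..Real.pi, (s + (r ^ 2 + l ^ 2 - 2 * r * l * Real.cos θ) ^ 1)⁻¹ =
      2 * Real.pi / rad r s l := by exact_mod_cast h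
  simp_rw [div_eq_mul_inv s]
  rw [intervalIntegral.integral_const_mul, h2]
  field_simp

/-- The Laplace transform of the interference for path loss exponent 2. -/
theorem IsNetwork.laplaceTransform_two {Ω : Type*} [MeasurableSpace Ω] {P : Measure Ω}
    [IsProbabilityMeasure P] {lam D R₁ R₂ : ℝ} (hlam : 0 < lam) (hR₁ : 0 < R₁) (hR₁₂ : R₁ ≤ R₂)
    (hR₂ : R₂ ≤ D) {pol : Policy} (hpol : pol = .I ∨ pol = .D → R₁ < R₂) {y : Plane}
    (hy : 0 < ‖y‖) {N : Ω → ℕ} {X : ℕ → Ω → Plane} {U h : ℕ → Ω → ℝ} {h₀ : Ω → ℝ}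
    (hnet : IsNetwork P lam D N X U h h₀) (hs : 0 < s) :
    laplaceTransform P (interference pol 2 R₁ R₂ N X U h y) s =
      laplace2 lam R₁ R₂ s ‖y‖ pol := by
  have hc : Continuous fun r => rad r s ‖y‖ := by unfold rad; fun_prop
  have h := hnet.laplaceTransform_eq_radialValue hlam hR₁ hR₁₂ hR₂ hpol (j := 1) one_pos hs
    (k := fun r => 2 * Real.pi * s * r / rad r s ‖y‖)
    (V₀ := fun r => Real.pi * s * ash r s ‖y‖)
    -- From `rad' = 2r (r² + s - l²) / rad`, the function `r² * 2r / rad` is `rad' - (s - l²) *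
    -- ash'`.
    (V₁ := fun r => Real.pi * s * (rad r s ‖y‖ - (s - ‖y‖ ^ 2) * ash r s ‖y‖))
    (Continuous.div (by fun_prop) hc fun r => (rad_pos hs hy r).ne')
    (fun r => by
      convert! (hasDerivAt_ash hs hy r).const_mul (Real.pi * s) using 1
      ring)
    (fun r => by
      convert! ((hasDerivAt_rad hs hy r).sub ((hasDerivAt_ash hs hy r).const_mul
        (s - ‖y‖ ^ 2))).const_mul (Real.pi * s) using 1
      ring)
    (fun r hr => integral_kernel_two hs hy hr)
  have h2 : (((2 * 1 : ℕ) : ℝ)) = 2 := by norm_num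
  rw [h2] at h
  rw [h]
  cases pol <;> simp only [radialValue, laplace2, Psi2I, Psi2D, ash_zero hs hy] <;> congr 1 <;> ring

end Exponent2

/-! ### Path loss exponent 4 -/

section Exponent4

open Complex in
/-- The complex number whose square root has real part `η` and imaginary part `ψ`. -/
noncomputable def quartic (r σ l : ℝ) : ℂ := ((r ^ 2 + l ^ 2 : ℝ) + σ * I) ^ 2 - (2 * r * l : ℝ) ^ 2

open Complex in
/-- The square root of `quartic` in the right half plane. -/
noncomputable def quarticRoot (r σ l : ℝ) : ℂ := cexp (log (quartic r σ l) / 2)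

open Complex in
/-- The argument of the complex logarithm occurring in the radial antiderivatives. -/
noncomputable def logArg (r σ l : ℝ) : ℂ := quarticRoot r σ l + (r ^ 2 - l ^ 2 : ℝ) + σ * I

open Complex in
/-- An antiderivative of `2 r ^ 5 / quarticRoot r`. -/
noncomputable def quarticPrimitive (r σ l : ℝ) : ℂ :=
  ((r ^ 2 : ℝ) - 3 * (σ * I - l ^ 2)) / 2 * quarticRoot r σ l +
    (3 * (σ * I - l ^ 2) ^ 2 - (l ^ 2 + σ * I) ^ 2) / 2 * log (logArg r σ l)

variable {σ l : ℝ}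

lemma quartic_re (r : ℝ) : (quartic r σ l).re = (r ^ 2 - l ^ 2) ^ 2 - σ ^ 2 := by
  simp [quartic, pow_two]
  ring

lemma quartic_im (r : ℝ) : (quartic r σ l).im = 2 * σ * (r ^ 2 + l ^ 2) := by
  simp [quartic, pow_two]
  ring

/-- Staying in the open upper half plane, the curve avoids the branch cut, so the root defined
through `log` is smooth in `r` and lies in the open first quadrant. -/
lemma quartic_im_pos (hσ : 0 < σ) (hl : 0 < l) (r : ℝ) : 0 < (quartic r σ l).im := by
  rw [quartic_im]
  positivity

lemma quartic_mem_slitPlane (hσ : 0 < σ) (hl : 0 < l) (r : ℝ) :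
    quartic r σ l ∈ Complex.slitPlane :=
  Or.inr (quartic_im_pos hσ hl r).ne'

lemma quarticRoot_sq (hσ : 0 < σ) (hl : 0 < l) (r : ℝ) :
    quarticRoot r σ l ^ 2 = quartic r σ l := by
  rw [quarticRoot, ← Complex.exp_nat_mul, Nat.cast_ofNat, mul_div_cancel₀ _ two_ne_zero,
    Complex.exp_log (Complex.slitPlane_ne_zero (quartic_mem_slitPlane hσ hl r))]

lemma quarticRoot_ne_zero (r : ℝ) : quarticRoot r σ l ≠ 0 := Complex.exp_ne_zero _

lemma quarticRoot_re_pos (hσ : 0 < σ) (hl : 0 < l) (r : ℝ) : 0 < (quarticRoot r σ l).re := by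
  rw [quarticRoot, Complex.exp_re]
  have him : (Complex.log (quartic r σ l) / 2).im = (quartic r σ l).arg / 2 := by
    rw [← Complex.log_im]
    simp
  rw [him]
  have h := quartic_im_pos hσ hl r
  have h1 : 0 ≤ (quartic r σ l).arg := Complex.arg_nonneg_iff.2 h.le
  have h2 : (quartic r σ l).arg < Real.pi :=
    lt_of_le_of_ne (Complex.arg_le_pi _) fun h' => h.ne' (Complex.arg_eq_pi_iff.1 h').2
  exact mul_pos (Real.exp_pos _) (Real.cos_pos_of_mem_Ioo ⟨by linarith [Real.pi_pos], by linarith⟩)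

lemma quarticRoot_re_sq_sub_im_sq (hσ : 0 < σ) (hl : 0 < l) (r : ℝ) :
    (quarticRoot r σ l).re ^ 2 - (quarticRoot r σ l).im ^ 2 = (r ^ 2 - l ^ 2) ^ 2 - σ ^ 2 := by
  have h := congrArg Complex.re (quarticRoot_sq hσ hl r)
  rw [quartic_re, sq, Complex.mul_re] at h
  linarith

lemma quarticRoot_re_mul_im (hσ : 0 < σ) (hl : 0 < l) (r : ℝ) :
    (quarticRoot r σ l).re * (quarticRoot r σ l).im = σ * (r ^ 2 + l ^ 2) := by
  have h := congrArg Complex.im (quarticRoot_sq hσ hl r)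
  rw [quartic_im, sq, Complex.mul_im] at h
  linarith

lemma quarticRoot_im_pos (hσ : 0 < σ) (hl : 0 < l) (r : ℝ) : 0 < (quarticRoot r σ l).im := by
  have h := quarticRoot_re_mul_im hσ hl r
  have h1 : 0 < σ * (r ^ 2 + l ^ 2) := by positivity
  rw [← h] at h1
  exact (mul_pos_iff_of_pos_left (quarticRoot_re_pos hσ hl r)).1 h1

/-- If the root is `a + ib`, then `a² + b²` is the modulus and `a² - b²` the real part of its
square; `η` is the root of their half-sum, with sign fixed by `a > 0`. -/
lemma quarticRoot_re_eq_eta (hσ : 0 < σ) (hl : 0 < l) (r : ℝ) :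
    (quarticRoot r σ l).re = eta r (σ ^ 2) l := by
  have h1 := quarticRoot_re_sq_sub_im_sq hσ hl r
  have h2 := quarticRoot_re_mul_im hσ hl r
  have h3 := quarticRoot_re_pos hσ hl r
  generalize (quarticRoot r σ l).re = a at *
  generalize (quarticRoot r σ l).im = b at *
  have h4 : g4 r (σ ^ 2) l ^ 2 + 4 * σ ^ 2 * (r ^ 2 + l ^ 2) ^ 2 = (a ^ 2 + b ^ 2) ^ 2 := by
    rw [g4, ← h1]
    linear_combination (-4 * (a * b + σ * (r ^ 2 + l ^ 2))) * h2
  rw [eta, h4, Real.sqrt_sq (by positivity), g4, ← h1, ← Real.sqrt_div' _ (by norm_num),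
    show (a ^ 2 + b ^ 2 + (a ^ 2 - b ^ 2)) / 2 = a ^ 2 by ring, Real.sqrt_sq h3.le]

lemma quarticRoot_im_eq_psi (hσ : 0 < σ) (hl : 0 < l) (r : ℝ) :
    (quarticRoot r σ l).im = psi r (σ ^ 2) l := by
  have h3 := quarticRoot_re_pos hσ hl r
  rw [psi, ← quarticRoot_re_eq_eta hσ hl, Real.sqrt_sq hσ.le, eq_div_iff h3.ne',
    ← quarticRoot_re_mul_im hσ hl r]
  ring

lemma logArg_re (r : ℝ) : (logArg r σ l).re = (quarticRoot r σ l).re + r ^ 2 - l ^ 2 := by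
  simp [logArg, pow_two]
  ring

lemma logArg_im (r : ℝ) : (logArg r σ l).im = σ + (quarticRoot r σ l).im := by
  simp [logArg, pow_two]
  ring

lemma logArg_mem_slitPlane (hσ : 0 < σ) (hl : 0 < l) (r : ℝ) :
    logArg r σ l ∈ Complex.slitPlane := by
  refine Or.inr ?_
  rw [logArg_im]
  exact (add_pos hσ (quarticRoot_im_pos hσ hl r)).ne'

/-- Suppose `a ≤ l² - r²`. Comparing real parts of the squared root gives `b ≤ σ`, so `a b ≤ (l² -
r²) σ`, contradicting `a b = σ (r² + l²)`. Strictness needs `r ≠ 0`. -/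
lemma logArg_re_pos (hσ : 0 < σ) (hl : 0 < l) {r : ℝ} (hr : 0 < r) : 0 < (logArg r σ l).re := by
  have h1 := quarticRoot_re_sq_sub_im_sq hσ hl r
  have h2 := quarticRoot_re_mul_im hσ hl r
  have h3 := quarticRoot_re_pos hσ hl r
  have h4 := quarticRoot_im_pos hσ hl r
  rw [logArg_re]
  generalize (quarticRoot r σ l).re = a at *
  generalize (quarticRoot r σ l).im = b at *
  by_contra hcon
  have h5 : a ≤ l ^ 2 - r ^ 2 := by linarith
  have h6 : b ≤ σ := by
    have : a ^ 2 ≤ (l ^ 2 - r ^ 2) ^ 2 := by gcongr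
    exact (sq_le_sq₀ h4.le hσ.le).1 (by nlinarith)
  have h7 : a * b ≤ (l ^ 2 - r ^ 2) * σ := by
    gcongr
    linarith
  have h8 : 0 < r ^ 2 * σ := by positivity
  nlinarith

/-- In the right half plane the argument is the `arctan` of the slope. -/
lemma log_logArg_im (hσ : 0 < σ) (hl : 0 < l) {r : ℝ} (hr : 0 < r) :
    (Complex.log (logArg r σ l)).im = atn r (σ ^ 2) l := by
  have hre := logArg_re_pos hσ hl hr
  have habs := abs_lt.1 (Complex.abs_arg_lt_pi_div_two_iff.2 (Or.inl hre))
  rw [Complex.log_im, atn, Real.sqrt_sq hσ.le, ← quarticRoot_re_eq_eta hσ hl,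
    ← quarticRoot_im_eq_psi hσ hl, ← logArg_re, ← logArg_im, ← Complex.tan_arg,
    Real.arctan_tan habs.1 habs.2]

lemma log_logArg_re (hσ : 0 < σ) (hl : 0 < l) (r : ℝ) :
    2 * (Complex.log (logArg r σ l)).re =
      Real.log ((eta r (σ ^ 2) l + r ^ 2 - l ^ 2) ^ 2 + (√(σ ^ 2) + psi r (σ ^ 2) l) ^ 2) := by
  rw [Complex.log_re, Real.sqrt_sq hσ.le, ← quarticRoot_re_eq_eta hσ hl,
    ← quarticRoot_im_eq_psi hσ hl, ← logArg_re, ← logArg_im, sq, sq, ← Complex.normSq_apply,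
    Complex.normSq_eq_norm_sq, Real.log_pow]
  norm_num

/-- At `r = 0` the quartic is a perfect square, and positivity of the real part selects the sign. -/
lemma quarticRoot_zero (hσ : 0 < σ) (hl : 0 < l) :
    quarticRoot 0 σ l = (l ^ 2 : ℝ) + σ * Complex.I := by
  have h1 : quarticRoot 0 σ l ^ 2 = ((l ^ 2 : ℝ) + σ * Complex.I) ^ 2 := by
    rw [quarticRoot_sq hσ hl, quartic]
    simp
  rcases sq_eq_sq_iff_eq_or_eq_neg.1 h1 with h | h
  · exact h
  · have h2 := quarticRoot_re_pos hσ hl 0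
    have h3 : 0 < l ^ 2 := by positivity
    rw [h] at h2
    simp [sq] at h2
    nlinarith

/-- The argument is `2σi`, on the imaginary axis, where the `arctan` formula would divide by zero.
The complex logarithm still gives the correct limit, the `π/2` of the final formula. -/
lemma log_logArg_zero_im (hσ : 0 < σ) (hl : 0 < l) :
    (Complex.log (logArg 0 σ l)).im = Real.pi / 2 := by
  have h : logArg 0 σ l = ((2 * σ : ℝ) : ℂ) * Complex.I := by
    rw [logArg, quarticRoot_zero hσ hl]
    push_cast
    ring
  rw [h, Complex.log_im, Complex.arg_real_mul _ (by positivity), Complex.arg_I]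

lemma hasDerivAt_quartic (r : ℝ) : HasDerivAt (fun r => quartic r σ l)
    (4 * r * ((r ^ 2 : ℝ) + (σ * Complex.I - l ^ 2))) r := by
  have h : HasDerivAt (fun z : ℂ => ((z ^ 2 + l ^ 2) + σ * Complex.I) ^ 2 - (2 * z * l) ^ 2)
      (4 * r * ((r ^ 2 : ℝ) + (σ * Complex.I - l ^ 2))) (r : ℂ) := by
    have h1 : HasDerivAt (fun z : ℂ => (z ^ 2 + l ^ 2) + σ * Complex.I) (2 * r) (r : ℂ) := by
      convert! ((hasDerivAt_pow 2 (r : ℂ)).add_const ((l : ℂ) ^ 2)).add_const (σ * Complex.I)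
        using 1
      norm_num
    have h2 : HasDerivAt (fun z : ℂ => 2 * z * l) (2 * l) (r : ℂ) := by
      convert! ((hasDerivAt_id (r : ℂ)).const_mul 2).mul_const (l : ℂ) using 1
      ring
    convert! (h1.pow 2).sub (h2.pow 2) using 1
    push_cast
    ring
  have h' := h.comp_ofReal
  convert! h' using 1
  ext r
  simp [quartic]

lemma hasDerivAt_quarticRoot (hσ : 0 < σ) (hl : 0 < l) (r : ℝ) :
    HasDerivAt (fun r => quarticRoot r σ l)
      (2 * r * ((r ^ 2 : ℝ) + (σ * Complex.I - l ^ 2)) / quarticRoot r σ l) r := by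
  have h := (((hasDerivAt_quartic (σ := σ) (l := l) r).clog_real
    (quartic_mem_slitPlane hσ hl r)).div_const 2).cexp
  convert! h using 1
  rw [← quarticRoot, ← quarticRoot_sq hσ hl]
  have := quarticRoot_ne_zero (σ := σ) (l := l) r
  field_simp
  ring

/-- With `w` the root and `c = σi - l²`, the derivative of `w + r² + c` is `2r (r² + c) / w + 2r`,
which is `2r / w` times `w + r² + c`. -/
lemma hasDerivAt_log_logArg (hσ : 0 < σ) (hl : 0 < l) (r : ℝ) :
    HasDerivAt (fun r => Complex.log (logArg r σ l)) (2 * r / quarticRoot r σ l) r := by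
  have h1 : HasDerivAt (fun r : ℝ => ((r ^ 2 - l ^ 2 : ℝ) : ℂ)) (2 * r) r := by
    have h := ((hasDerivAt_pow 2 r).sub_const (l ^ 2)).ofReal_comp
    convert! h using 1
    push_cast
    ring
  have h := (((hasDerivAt_quarticRoot hσ hl r).add h1).add_const (σ * Complex.I)).clog_real
    (logArg_mem_slitPlane hσ hl r)
  convert! h using 1
  have h2 := quarticRoot_ne_zero (σ := σ) (l := l) r
  have h3 := Complex.slitPlane_ne_zero (logArg_mem_slitPlane hσ hl r)
  change _ = _ / logArg r σ l
  rw [eq_div_iff h3, logArg]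
  field_simp
  push_cast
  ring

/-- With `u = r²`, `c = σi - l²` and `q = (l² + σi)²` one has `w² = u² + 2cu + q`, and this is the
classical `∫ u² / w du = (u - 3c) w / 2 + (3c² - q) / 2 * log (w + u + c)`. -/
lemma hasDerivAt_quarticPrimitive (hσ : 0 < σ) (hl : 0 < l) (r : ℝ) :
    HasDerivAt (fun r => quarticPrimitive r σ l)
      ((r ^ 4 : ℝ) * (2 * r / quarticRoot r σ l)) r := by
  have h1 : HasDerivAt (fun r : ℝ => (((r ^ 2 : ℝ) : ℂ) - 3 * (σ * Complex.I - (l : ℂ) ^ 2)) / 2)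
      (r : ℂ) r := by
    have h := (((hasDerivAt_pow 2 r).ofReal_comp).sub_const
      (3 * (σ * Complex.I - (l : ℂ) ^ 2))).div_const 2
    convert! h using 1
    push_cast
    ring
  have h := (h1.mul (hasDerivAt_quarticRoot hσ hl r)).add ((hasDerivAt_log_logArg hσ hl r).const_mul
    ((3 * (σ * Complex.I - (l : ℂ) ^ 2) ^ 2 - (l ^ 2 + σ * Complex.I) ^ 2) / 2))
  convert! h using 1
  have h2 := quarticRoot_ne_zero (σ := σ) (l := l) r
  have h3 := quarticRoot_sq hσ hl r
  rw [quartic] at h3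
  field_simp
  push_cast at h3 ⊢
  linear_combination (-(r : ℂ)) * h3

lemma quarticPrimitive_im (hσ : 0 < σ) (hl : 0 < l) {r : ℝ} (hr : 0 < r) :
    (quarticPrimitive r σ l).im =
      ((r ^ 2 + 3 * l ^ 2) * psi r (σ ^ 2) l - 3 * σ * eta r (σ ^ 2) l) / 2 +
      (l ^ 4 - σ ^ 2) * atn r (σ ^ 2) l - 2 * σ * l ^ 2 *
        Real.log ((eta r (σ ^ 2) l + r ^ 2 - l ^ 2) ^ 2 + (√(σ ^ 2) + psi r (σ ^ 2) l) ^ 2) := by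
  have hc1 : (((r ^ 2 : ℝ) : ℂ) - 3 * (σ * Complex.I - l ^ 2)) / 2 =
      (((r ^ 2 + 3 * l ^ 2) / 2 : ℝ) : ℂ) + ((-3 * σ / 2 : ℝ) : ℂ) * Complex.I := by
    push_cast
    ring
  have hc2 : (3 * (σ * Complex.I - (l : ℂ) ^ 2) ^ 2 - (l ^ 2 + σ * Complex.I) ^ 2) / 2 =
      ((l ^ 4 - σ ^ 2 : ℝ) : ℂ) + ((-4 * σ * l ^ 2 : ℝ) : ℂ) * Complex.I := by
    push_cast
    linear_combination (σ : ℂ) ^ 2 * Complex.I_sq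
  rw [← log_logArg_re hσ hl, ← log_logArg_im hσ hl hr, ← quarticRoot_re_eq_eta hσ hl,
    ← quarticRoot_im_eq_psi hσ hl, quarticPrimitive, hc1, hc2]
  simp only [Complex.add_im, Complex.mul_im, Complex.add_re, Complex.mul_re, Complex.ofReal_re,
    Complex.ofReal_im, Complex.I_re, Complex.I_im]
  ring

/-- For real `x`, `σ² / (σ² + x²) = -σ Im (1 / (x + iσ))`, which reduces the kernel to the angular
formula with complex `A`. Both `A` and the root lie in the first quadrant, so the root is on the
side of `A`. -/
lemma integral_kernel_four (hσ : 0 < σ) (hl : 0 < l) {r : ℝ} (hr : 0 < r) :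
    ∫ θ in (-Real.pi)..Real.pi, σ ^ 2 / (σ ^ 2 + (r ^ 2 + l ^ 2 - 2 * r * l * Real.cos θ) ^ 2) =
      -(Real.pi * σ) * (2 * r / quarticRoot r σ l).im / r := by
  set A : ℂ := ((r ^ 2 + l ^ 2 : ℝ) : ℂ) + σ * Complex.I with hA
  have hre := quarticRoot_re_pos hσ hl r
  have him := quarticRoot_im_pos hσ hl r
  have h := integral_inv_sub_mul_cos (A := A) (w := quarticRoot r σ l) (B := 2 * r * l)
    (by positivity) (by rw [quarticRoot_sq hσ hl, quartic]) (by
      have : (A * (starRingEnd ℂ) (quarticRoot r σ l)).re =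
          (r ^ 2 + l ^ 2) * (quarticRoot r σ l).re + σ * (quarticRoot r σ l).im := by
        rw [Complex.mul_re, Complex.conj_re, Complex.conj_im, hA]
        simp only [Complex.add_im, Complex.mul_im, Complex.add_re, Complex.mul_re,
          Complex.ofReal_re, Complex.ofReal_im, Complex.I_re, Complex.I_im]
        ring
      rw [this]
      positivity)
  have hsub : ∀ θ : ℝ, A - ((2 * r * l : ℝ) : ℂ) * Real.cos θ =
      ((r ^ 2 + l ^ 2 - 2 * r * l * Real.cos θ : ℝ) : ℂ) + σ * Complex.I := by
    intro θ
    rw [hA]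
    push_cast
    ring
  have hne : ∀ θ : ℝ, A - ((2 * r * l : ℝ) : ℂ) * Real.cos θ ≠ 0 := by
    intro θ h0
    have h1 := congrArg Complex.im h0
    rw [hsub, Complex.add_im, Complex.ofReal_im, Complex.mul_im] at h1
    simp at h1
    exact hσ.ne' h1
  have hcont : Continuous fun θ : ℝ => (A - ((2 * r * l : ℝ) : ℂ) * Real.cos θ)⁻¹ :=
    Continuous.inv₀ (by fun_prop) hne
  have himag : ∫ θ in (-Real.pi)..Real.pi, ((A - ((2 * r * l : ℝ) : ℂ) * Real.cos θ)⁻¹).im =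
      (2 * Real.pi / quarticRoot r σ l).im := by
    rw [← h]
    exact Complex.imCLM.intervalIntegral_comp_comm (hcont.intervalIntegrable _ _)
  have hpt : ∀ θ : ℝ, σ ^ 2 / (σ ^ 2 + (r ^ 2 + l ^ 2 - 2 * r * l * Real.cos θ) ^ 2) =
      -σ * ((A - ((2 * r * l : ℝ) : ℂ) * Real.cos θ)⁻¹).im := by
    intro θ
    rw [hsub, Complex.inv_im, Complex.normSq_add_mul_I]
    simp only [Complex.add_im, Complex.mul_im, Complex.ofReal_re, Complex.ofReal_im,
      Complex.I_re, Complex.I_im]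
    ring
  rw [intervalIntegral.integral_congr (fun θ _ => hpt θ), intervalIntegral.integral_const_mul,
    himag]
  have e1 : 2 * (Real.pi : ℂ) / quarticRoot r σ l =
      ((2 * Real.pi : ℝ) : ℂ) * (quarticRoot r σ l)⁻¹ := by push_cast; ring
  have e2 : 2 * (r : ℂ) / quarticRoot r σ l = ((2 * r : ℝ) : ℂ) * (quarticRoot r σ l)⁻¹ := by
    push_cast; ring
  rw [e1, e2, Complex.im_ofReal_mul, Complex.im_ofReal_mul]
  field_simp

lemma _root_.HasDerivAt.im_ofReal {f : ℝ → ℂ} {f' : ℂ} {x : ℝ} (h : HasDerivAt f f' x) :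
    HasDerivAt (fun t => (f t).im) f'.im x :=
  Complex.imCLM.hasFDerivAt.comp_hasDerivAt x h

/-- The Laplace transform of the interference for path loss exponent 4. -/
theorem IsNetwork.laplaceTransform_four {Ω : Type*} [MeasurableSpace Ω] {P : Measure Ω}
    [IsProbabilityMeasure P] {lam D R₁ R₂ : ℝ} (hlam : 0 < lam) (hR₁ : 0 < R₁) (hR₁₂ : R₁ ≤ R₂)
    (hR₂ : R₂ ≤ D) {pol : Policy} (hpol : pol = .I ∨ pol = .D → R₁ < R₂) {y : Plane}
    (hy : 0 < ‖y‖) {N : Ω → ℕ} {X : ℕ → Ω → Plane} {U h : ℕ → Ω → ℝ} {h₀ : Ω → ℝ}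
    (hnet : IsNetwork P lam D N X U h h₀) (hσ : 0 < σ) :
    laplaceTransform P (interference pol 4 R₁ R₂ N X U h y) (σ ^ 2) =
      laplace4 lam R₁ R₂ (σ ^ 2) ‖y‖ pol := by
  have hroot : Continuous fun r => quarticRoot r σ ‖y‖ :=
    continuous_iff_continuousAt.2 fun r => (hasDerivAt_quarticRoot hσ hy r).continuousAt
  have hk : Continuous fun r : ℝ => (2 * r / quarticRoot r σ ‖y‖ : ℂ) :=
    Continuous.div (by fun_prop) hroot fun r => quarticRoot_ne_zero r
  have h := hnet.laplaceTransform_eq_radialValue hlam hR₁ hR₁₂ hR₂ hpol (j := 2) two_pos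
    (sq_pos_of_pos hσ)
    (k := fun r => -(Real.pi * σ) * (2 * r / quarticRoot r σ ‖y‖).im)
    -- The antiderivative is kept as a complex logarithm, not as `atn`, so that it is differentiable
    -- at every `r`, including the lower endpoint `0`.
    (V₀ := fun r => -(Real.pi * σ) * (Complex.log (logArg r σ ‖y‖)).im)
    (V₁ := fun r => -(Real.pi * σ) * (quarticPrimitive r σ ‖y‖).im)
    (continuous_const.mul (Complex.continuous_im.comp hk))
    (fun r => (hasDerivAt_log_logArg hσ hy r).im_ofReal.const_mul _)
    (fun r => by
      convert! (hasDerivAt_quarticPrimitive hσ hy r).im_ofReal.const_mul (-(Real.pi * σ)) using 1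
      rw [Complex.im_ofReal_mul]
      ring)
    (fun r hr => integral_kernel_four hσ hy hr)
  have h2 : (((2 * 2 : ℕ) : ℝ)) = 4 := by norm_num
  have hR₂' := hR₁.trans_le hR₁₂
  rw [h2] at h
  rw [h]
  cases pol <;> simp only [radialValue, laplace4, Psi4I, Psi4D, log_logArg_zero_im hσ hy,
    quarticPrimitive_im hσ hy hR₁, quarticPrimitive_im hσ hy hR₂', log_logArg_im hσ hy hR₁,
    log_logArg_im hσ hy hR₂', Real.sqrt_sq hσ.le] <;> generalize R₂ ^ 4 - R₁ ^ 4 = Δ <;> congr 1 <;> ring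

end Exponent4

end FriendlyJamming

theorem theorem3 {Ω : Type*} [MeasurableSpace Ω] (P : Measure Ω) [IsProbabilityMeasure P]
    (lam D R₁ R₂ : ℝ) (hlam : 0 < lam) (hR₁ : 0 < R₁) (hR₁₂ : R₁ ≤ R₂) (hR₂ : R₂ ≤ D)
    (pol : FriendlyJamming.Policy) (hpol : pol = .I ∨ pol = .D → R₁ < R₂)
    (α : ℝ) (hα : 2 ≤ α)
    (y₀ : FriendlyJamming.Plane) (l : ℝ) (hl : ‖y₀‖ = l) (hl_pos : 0 < l) (hlD : l ≤ D)
    (β : ℝ) (hβ : 0 < β)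
    (N : Ω → ℕ) (X : ℕ → Ω → FriendlyJamming.Plane) (U h : ℕ → Ω → ℝ) (h₀ : Ω → ℝ)
    (hnet : FriendlyJamming.IsNetwork P lam D N X U h h₀) :
    FriendlyJamming.transmissionOutage P pol α R₁ R₂ N X U h h₀ y₀ β =
        1 - FriendlyJamming.laplaceTransform P
          (FriendlyJamming.interference pol α R₁ R₂ N X U h y₀) (β * l ^ α) ∧
      (α = 2 →
        FriendlyJamming.laplaceTransform P
            (FriendlyJamming.interference pol α R₁ R₂ N X U h y₀) (β * l ^ α) =
          FriendlyJamming.laplace2 lam R₁ R₂ (β * l ^ α) l pol) ∧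
      (α = 4 →
        FriendlyJamming.laplaceTransform P
            (FriendlyJamming.interference pol α R₁ R₂ N X U h y₀) (β * l ^ α) =
          FriendlyJamming.laplace4 lam R₁ R₂ (β * l ^ α) l pol) := by

  have hy : 0 < ‖y₀‖ := hl ▸ hl_pos
  subst hl
  refine ⟨hnet.transmissionOutage_eq hy hβ, ?_, ?_⟩
  · rintro rfl
    exact hnet.laplaceTransform_two hlam hR₁ hR₁₂ hR₂ hpol hy (by positivity)
  · rintro rfl
    have hs : 0 < β * ‖y₀‖ ^ (4 : ℝ) := by positivity
    -- The exponent-4 computation is parametrized by `σ = √s`.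
    have h := hnet.laplaceTransform_four hlam hR₁ hR₁₂ hR₂ hpol hy (Real.sqrt_pos.2 hs)
    rwa [Real.sq_sqrt hs.le] at h
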